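/- Let $A\ge 2$ and let $F_1,\dots,F_A:\mathbb{N}=\{1,2,\dots\}\to(0,\infty)$ be feedback functions. Let $(X(n))_{n\ge0}$ be the generalized Pólya urn with $A$ colours started from a fixed $X(0)\in\mathbb{N}^A$, i.e. the Markov chain on $\mathbb{N}^A$ with $$\mathbb{P}\big(X(n+1)=X(n)+e^{(i)}\,\big|\,X(0),\dots,X(n)\big)=\frac{F_i(X_i(n))}{\sum_{j=1}^A F_j(X_j(n))},\qquad i=1,\dots,A,$$ where $e^{(i)}$ is the $i$-th unit vector. Put $X_i(\infty)=\lim_{n\to\infty}X_i(n)\in\mathbb{N}\cup\{\infty\}$ and let $sMon_i$ be the event that there is $N$ such that $X_j(n)=X_j(N)$ for all $n\ge N$ and all $j\neq i$ (colour $i$ is the monopolist). Let $\tau_j(k)$ ($1\le j\le A$, $k\ge1$) be independent random variables, $\tau_j(k)$ being exponentially distributed with parameter $F_j(k)$, and let $T_j=\sum_{k\ge X_j(0)}\tau_j(k)\in(0,\infty]$; that is, $T_1,\dots,T_A$ are the explosion times of independent birth processes with rate functions $F_j$ and initial values $X_j(0)$. Say that colour $j$ satisfies the explosion condition if $\sum_{k\ge1}1/F_j(k)<\infty$.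 Assume that at least two colours satisfy it and that colour $i$ is one of them. Then $t\mapsto\mathbb{P}(T_i\le t)$ is differentiable; write $g_i(t)=\frac{d}{dt}\mathbb{P}(T_i\le t)$ for the density of $T_i$. As $x\to\infty$, $$\mathbb{P}(X_i(\infty)=x)\sim\frac{\mathbb{E}\,g_i(\min_{j\ne i}T_j)}{F_i(x)}$$ and $$\mathbb{P}\big(X_i(\infty)>x\,\big|\,sMon_i^c\big)\sim\frac{\mathbb{E}\,g_i(\min_{j\ne i}T_j)}{\mathbb{P}(T_i>\min_{j\ne i}T_j)}\sum_{k=x+1}^\infty\frac1{F_i(k)},$$ where $u_x\sim v_x$ means $u_x/v_x\to1$. -/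

import Mathlib

open MeasureTheory ProbabilityTheory Filter Topology
open scoped ENNReal

namespace PolyaUrn

/-- The explosion condition `∑_{k ≥ 1} 1 / F k < ∞` for a feedback function `F : {1, 2, …} → (0, ∞)`.
(Feedback functions are total on `ℕ`; the value at `0` is never used.) -/
def Explosive (F : ℕ → ℝ) : Prop :=
  Summable fun k : ℕ => 1 / F (k + 1)

/-- `X` is a generalized Pólya urn with feedback functions `F` started from the configuration `x₀`:
a discrete-time Markov process such that, given the past up to time `n`, one unit is added to
colour `i` with probability `F_i (X_i n) / ∑_j F_j (X_j n)`. -/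
structure IsUrn {A : ℕ} {Ω : Type*} [MeasurableSpace Ω] (F : Fin A → ℕ → ℝ) (x₀ : Fin A → ℕ)
    (X : ℕ → Ω → Fin A → ℕ) (μ : Measure Ω) : Prop where
  measurable : ∀ n, Measurable (X n)
  init : ∀ᵐ ω ∂μ, X 0 ω = x₀
  step : ∀ (n : ℕ) (y : ℕ → Fin A → ℕ) (i : Fin A),
    μ {ω | (∀ m ≤ n, X m ω = y m) ∧ X (n + 1) ω = X n ω + Pi.single i 1} =
      ENNReal.ofReal (F i (y n i) / ∑ j, F j (y n j)) * μ {ω | ∀ m ≤ n, X m ω = y m}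

/-- `X_i(∞)`, the final number of balls of colour `i`. The counts are almost surely nondecreasing in
time, so the limit is the supremum. -/
noncomputable def finalCount {A : ℕ} {Ω : Type*} (X : ℕ → Ω → Fin A → ℕ) (i : Fin A) (ω : Ω) : ℕ∞ :=
  ⨆ n, (X n ω i : ℕ∞)

/-- Strong monopoly of colour `i`: from some time on, no other colour is drawn. -/
def strongMonopoly {A : ℕ} {Ω : Type*} (X : ℕ → Ω → Fin A → ℕ) (i : Fin A) : Set Ω :=
  {ω | ∃ N, ∀ n ≥ N, ∀ j, j ≠ i → X n ω j = X N ω j}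

/-- `τ i k`, for `k ≥ 1`, are the sojourn times of independent birth processes with rate functions
`F i`: independent, and `τ i k` is exponentially distributed with parameter `F i k`. -/
structure IsSojournTimes {A : ℕ} {Ω : Type*} [MeasurableSpace Ω] (F : Fin A → ℕ → ℝ)
    (τ : Fin A → ℕ → Ω → ℝ) (P : Measure Ω) : Prop where
  hasLaw : ∀ i k, 1 ≤ k → HasLaw (τ i k) (expMeasure (F i k)) P
  indep : iIndepFun (fun p : Fin A × ℕ+ => τ p.1 p.2) P

/-- The explosion time `T_i = ∑_{k ≥ x₀ i} τ i k ∈ [0, ∞]` of the `i`-th birth process, started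
from `x₀ i`. -/
noncomputable def explosionTime {A : ℕ} {Ω : Type*} (x₀ : Fin A → ℕ) (τ : Fin A → ℕ → Ω → ℝ)
    (i : Fin A) (ω : Ω) : ℝ≥0∞ :=
  ∑' k : ℕ, ENNReal.ofReal (τ i (x₀ i + k) ω)

/-- `min_{j ≠ i} T_j`. -/
noncomputable def minOther {A : ℕ} {Ω : Type*} (x₀ : Fin A → ℕ) (τ : Fin A → ℕ → Ω → ℝ)
    (i : Fin A) (ω : Ω) : ℝ≥0∞ :=
  ⨅ j : {j : Fin A // j ≠ i}, explosionTime x₀ τ j ω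

/-- The distribution function `t ↦ P(T_i ≤ t)`, `t ∈ ℝ`. -/
noncomputable def explosionCDF {A : ℕ} {Ω : Type*} [MeasurableSpace Ω] (x₀ : Fin A → ℕ)
    (τ : Fin A → ℕ → Ω → ℝ) (P : Measure Ω) (i : Fin A) (t : ℝ) : ℝ :=
  P.real {ω | (explosionTime x₀ τ i ω : EReal) ≤ (t : EReal)}

/-- The density `g_i(t) = d/dt P(T_i ≤ t)` of the explosion time. -/
noncomputable def explosionDensity {A : ℕ} {Ω : Type*} [MeasurableSpace Ω] (x₀ : Fin A → ℕ)
    (τ : Fin A → ℕ → Ω → ℝ) (P : Measure Ω) (i : Fin A) (t : ℝ) : ℝ :=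
  deriv (explosionCDF x₀ τ P i) t

/-- `E g_i(min_{j ≠ i} T_j)`. (The minimum is almost surely finite as soon as some colour other
than `i` satisfies the explosion condition.) -/
noncomputable def meanDensity {A : ℕ} {Ω : Type*} [MeasurableSpace Ω] (x₀ : Fin A → ℕ)
    (τ : Fin A → ℕ → Ω → ℝ) (P : Measure Ω) (i : Fin A) : ℝ :=
  ∫ ω, explosionDensity x₀ τ P i (minOther x₀ τ i ω).toReal ∂P

end PolyaUrn

/-! The proof rests on the exponential embedding. If every colour runs its own birth process with
independent exponential sojourn times, the sequence of jumping colours has the law of the urn, and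
colour `i` is drawn at least `m` times exactly when its `m`-th birth precedes `M`, the first
explosion among the other colours. The urn `X` is not built from clocks. Instead, memorylessness at
the first jump gives the probabilities of `reachEvent` the same one-step recursion as the urn;
induction on the number of draws and a passage to the limit yield `IsUrn.measure_le_finalCount`.

Hence the final count equals `x` exactly when `M` falls into the sojourn of colour `i` at level `x`.
The tail of an exponential variable is its density divided by its rate, so integrating out this
sojourn produces the factor `1 / F i x` times the density, at `M`, of the partial sum of sojourns of
colour `i` up to and including that one. In this density the last sojourn can be exchanged with the
first, because convolution is commutative (`sojournLaw_lt_minTotal_eq_add`). The integrand then has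
a fixed rate, is bounded, and is continuous off a null event, so dominated convergence gives the
limit `meanPDF`, which is positive and finite. Differentiating the distribution function of `T_i`
under the integral, and using that `M` is independent of the clocks of colour `i`, identifies
`meanPDF` with the mean of `g_i` at `M` (`IsSojournTimes.meanDensity_eq`).

For the second asymptotics, explosion times have no finite ties, so almost surely exactly one colour
has infinite final count; strong monopoly of `i` is thus the event of an infinite count, and its
complement has probability `P(M < T_i)`. Summing the pointwise equivalence over the tail finishes
the proof. -/

namespace PolyaUrn

/-! ### Exponential laws: memorylessness, densities, convolution. -/

section Exponential

lemma measurable_exponentialPDF (r : ℝ) : Measurable (exponentialPDF r) :=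
  (measurable_exponentialPDFReal r).ennreal_ofReal

lemma lintegral_expMeasure (r : ℝ) {f : ℝ → ℝ≥0∞} (hf : Measurable f) :
    ∫⁻ s, f s ∂expMeasure r = ∫⁻ s, exponentialPDF r s * f s :=
  lintegral_withDensity_eq_lintegral_mul _ (measurable_exponentialPDF r) hf

lemma expMeasure_apply (r : ℝ) {B : Set ℝ} (hB : MeasurableSet B) :
    expMeasure r B = ∫⁻ s, exponentialPDF r s * B.indicator 1 s := by
  rw [← lintegral_expMeasure r (measurable_one.indicator hB), lintegral_indicator_one hB]

instance nullSingletonClass_expMeasure (r : ℝ) : NullSingletonClass (expMeasure r) :=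
  inferInstanceAs (NullSingletonClass (volume.withDensity (exponentialPDF r)))

lemma ae_pos_expMeasure (r : ℝ) : ∀ᵐ s ∂expMeasure r, 0 < s := by
  have h : MeasurableSet {s : ℝ | 0 < s}ᶜ := measurableSet_Ioi.compl
  rw [ae_iff, ← Set.compl_ofPred, expMeasure_apply r h]
  refine (lintegral_congr_ae ?_).trans lintegral_zero
  filter_upwards [compl_mem_ae_iff.2 (measure_singleton (0 : ℝ))] with s hs
  rcases lt_or_ge 0 s with h0 | h0
  · simp [h0]
  · rw [exponentialPDF_of_neg (lt_of_le_of_ne h0 hs), zero_mul]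

/-- The translation `v = u + s` splits the exponential density into `exp (-(r * s))` and the density
at `u`. The point `u = 0`, where the strict inequality and the support of the density disagree, is
null. -/
lemma expMeasure_memoryless (r : ℝ) {s : ℝ} (hs : 0 ≤ s) {B : Set ℝ}
    (hB : MeasurableSet B) :
    expMeasure r {v | s < v ∧ v - s ∈ B} = ENNReal.ofReal (Real.exp (-(r * s))) * expMeasure r B := by
  have hm : MeasurableSet {v : ℝ | s < v ∧ v - s ∈ B} :=
    measurableSet_Ioi.inter (hB.preimage (measurable_id.sub_const s))
  have hm' : Measurable fun u => exponentialPDF r u * B.indicator 1 u :=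
    (measurable_exponentialPDF r).mul (measurable_one.indicator hB)
  rw [expMeasure_apply r hm, expMeasure_apply r hB, ← lintegral_const_mul _ hm',
    ← lintegral_add_right_eq_self _ s]
  refine lintegral_congr_ae ?_
  filter_upwards [compl_mem_ae_iff.2 (measure_singleton (0 : ℝ))] with u hu
  rcases lt_or_gt_of_ne hu with h | h
  · simp [exponentialPDF_of_neg h, not_lt.2 h.le]
  · rw [exponentialPDF_of_nonneg h.le, exponentialPDF_of_nonneg (by linarith), ← mul_assoc,
      ← ENNReal.ofReal_mul (by positivity), mul_left_comm, ← Real.exp_add]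
    have : -(r * (u + s)) = -(r * s) + -(r * u) := by ring
    rw [this]
    congr 1
    by_cases hb : u ∈ B <;> simp [h, hb]

lemma expMeasure_Ioi {r : ℝ} (hr : 0 < r) {s : ℝ} (hs : 0 ≤ s) :
    expMeasure r (Set.Ioi s) = ENNReal.ofReal (Real.exp (-(r * s))) := by
  have := isProbabilityMeasure_expMeasure hr
  have h := expMeasure_memoryless r hs MeasurableSet.univ
  have h' : {v : ℝ | s < v ∧ v - s ∈ Set.univ} = Set.Ioi s := by ext; simp
  rwa [h', measure_univ, mul_one] at h

lemma lintegral_exp_neg_expMeasure {a c : ℝ} (ha : 0 < a) (hc : 0 ≤ c) :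
    ∫⁻ s, ENNReal.ofReal (Real.exp (-(c * s))) ∂expMeasure a = ENNReal.ofReal (a / (a + c)) := by
  rw [lintegral_expMeasure a (by fun_prop)]
  have h : ∀ s, exponentialPDF a s * ENNReal.ofReal (Real.exp (-(c * s))) =
      ENNReal.ofReal (a / (a + c)) * exponentialPDF (a + c) s := by
    intro s
    rcases lt_or_ge s 0 with h | h
    · simp [exponentialPDF_of_neg h]
    · rw [exponentialPDF_of_nonneg h, exponentialPDF_of_nonneg h,
        ← ENNReal.ofReal_mul (by positivity), ← ENNReal.ofReal_mul (by positivity), mul_assoc,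
        ← Real.exp_add, ← mul_assoc, div_mul_cancel₀ _ (by positivity)]
      ring_nf
  simp_rw [h]
  rw [lintegral_const_mul _ (measurable_exponentialPDF _),
    lintegral_exponentialPDF_eq_one (by linarith), mul_one]

/-- The density of an exponential variable is the rate times the tail. -/
lemma expMeasure_setOf_nonneg_and_lt {r : ℝ} (hr : 0 < r) (u : ℝ) :
    expMeasure r {s | 0 ≤ u ∧ u < s} = ENNReal.ofReal (1 / r) * exponentialPDF r u := by
  rcases lt_or_ge u 0 with h | h
  · simp [exponentialPDF_of_neg h, not_le.2 h]
  · have : {s | 0 ≤ u ∧ u < s} = Set.Ioi u := by ext s; simp [h]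
    rw [this, expMeasure_Ioi hr h, exponentialPDF_of_nonneg h, ← ENNReal.ofReal_mul (by positivity),
      ← mul_assoc, one_div, inv_mul_cancel₀ hr.ne', one_mul]

/-- Only a bound of order `1 / r` is needed, not the exact mean. The inequality `r * s ≤ 2 * exp (r
/ 2 * s)` absorbs the factor `s` at the price of halving the rate. -/
lemma lintegral_ofReal_expMeasure_le {r : ℝ} (hr : 0 < r) :
    ∫⁻ s, ENNReal.ofReal s ∂expMeasure r ≤ ENNReal.ofReal (4 * (1 / r)) := by
  have h : ∀ s, exponentialPDF r s * ENNReal.ofReal s ≤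
      ENNReal.ofReal (4 * (1 / r)) * exponentialPDF (r / 2) s := by
    intro s
    rcases lt_or_ge s 0 with h | h
    · simp [exponentialPDF_of_neg h]
    · rw [exponentialPDF_of_nonneg h, exponentialPDF_of_nonneg h,
        ← ENNReal.ofReal_mul (by positivity), ← ENNReal.ofReal_mul (by positivity)]
      refine ENNReal.ofReal_le_ofReal ?_
      have h1 : r * s ≤ 2 * Real.exp (r / 2 * s) := by
        have := Real.add_one_le_exp (r / 2 * s)
        linarith
      have h2 : Real.exp (-(r * s)) = Real.exp (-(r / 2 * s)) * Real.exp (-(r / 2 * s)) := by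
        rw [← Real.exp_add]; ring_nf
      have h3 : Real.exp (r / 2 * s) * Real.exp (-(r / 2 * s)) = 1 := by
        rw [← Real.exp_add]; simp
      calc r * Real.exp (-(r * s)) * s
          = r * s * (Real.exp (-(r / 2 * s)) * Real.exp (-(r / 2 * s))) := by rw [h2]; ring
        _ ≤ 2 * Real.exp (r / 2 * s) * (Real.exp (-(r / 2 * s)) * Real.exp (-(r / 2 * s))) := by
          gcongr
        _ = 2 * Real.exp (-(r / 2 * s)) := by rw [mul_assoc, ← mul_assoc (Real.exp _), h3, one_mul]
        _ = 4 * (1 / r) * (r / 2 * Real.exp (-(r / 2 * s))) := by field_simp; norm_num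
  rw [lintegral_expMeasure r (by fun_prop)]
  refine (lintegral_mono h).trans ?_
  rw [lintegral_const_mul _ (measurable_exponentialPDF _),
    lintegral_exponentialPDF_eq_one (by linarith), mul_one]

/-- The convolution of two exponential densities is commutative. -/
lemma lintegral_exponentialPDF_sub_comm (a b u : ℝ) :
    ∫⁻ s, exponentialPDF b (u - s) ∂expMeasure a = ∫⁻ s, exponentialPDF a (u - s) ∂expMeasure b := by
  have hm : ∀ c, Measurable fun s => exponentialPDF c (u - s) := fun c =>
    (measurable_exponentialPDF c).comp (by fun_prop)
  rw [lintegral_expMeasure a (hm b), lintegral_expMeasure b (hm a), ← lintegral_sub_left_eq_self _ u]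
  simp [mul_comm]

lemma exponentialPDF_le {r : ℝ} (hr : 0 < r) (u : ℝ) : exponentialPDF r u ≤ ENNReal.ofReal r := by
  rcases lt_or_ge u 0 with h | h
  · simp [exponentialPDF_of_neg h]
  · rw [exponentialPDF_of_nonneg h]
    refine ENNReal.ofReal_le_ofReal (mul_le_of_le_one_right hr.le (Real.exp_le_one_iff.2 ?_))
    have := mul_nonneg hr.le h
    linarith

lemma continuousAt_exponentialPDF (r : ℝ) {u : ℝ} (hu : u ≠ 0) :
    ContinuousAt (exponentialPDF r) u := by
  rcases lt_or_gt_of_ne hu with h | h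
  · have : exponentialPDF r =ᶠ[𝓝 u] fun _ => 0 := by
      filter_upwards [eventually_lt_nhds h] with s hs using exponentialPDF_of_neg hs
    exact continuousAt_const.congr this.symm
  · have : exponentialPDF r =ᶠ[𝓝 u] fun s => ENNReal.ofReal (r * Real.exp (-(r * s))) := by
      filter_upwards [eventually_gt_nhds h] with s hs using exponentialPDF_of_nonneg hs.le
    refine ContinuousAt.congr ?_ this.symm
    exact (ENNReal.continuous_ofReal.comp (by fun_prop)).continuousAt

end Exponential

/-! ### Resampling one coordinate of a product measure. -/

section Resampling

variable {ι : Type*} [DecidableEq ι] {X : ι → Type*} [∀ i, MeasurableSpace (X i)]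

lemma measurable_update_prod (p : ι) :
    Measurable fun z : (∀ i, X i) × X p => Function.update z.1 p z.2 := by
  refine measurable_pi_iff.2 fun i => ?_
  rcases eq_or_ne i p with rfl | h
  · simpa using measurable_snd
  · simp only [Function.update_of_ne h]
    exact (measurable_pi_apply i).comp measurable_fst

lemma map_update_infinitePi (ν : ∀ i, Measure (X i)) [∀ i, IsProbabilityMeasure (ν i)] (p : ι) :
    ((Measure.infinitePi ν).prod (ν p)).map (fun z => Function.update z.1 p z.2) =
      Measure.infinitePi ν := by
  have hmeas := measurable_update_prod (X := X) p
  refine Measure.eq_infinitePi _ fun s t ht => ?_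
  rw [Measure.map_apply hmeas (MeasurableSet.pi s.countable_toSet fun i _ => ht i)]
  have hpre : (fun z : (∀ i, X i) × X p => Function.update z.1 p z.2) ⁻¹' (Set.pi s t) =
      (Set.pi (s.erase p : Finset ι) t) ×ˢ (if p ∈ s then t p else Set.univ) := by
    ext z
    simp only [Set.mem_preimage, Set.mem_pi, Set.mem_prod, Finset.mem_coe, Finset.mem_erase]
    constructor
    · intro h
      refine ⟨fun i hi => by simpa [Function.update_of_ne hi.1] using h i hi.2, ?_⟩
      split_ifs with hp
      · simpa using h p hp
      · trivial
    · rintro ⟨h1, h2⟩ i hi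
      rcases eq_or_ne i p with rfl | h
      · simpa [hi] using h2
      · simpa [Function.update_of_ne h] using h1 i ⟨h, hi⟩
  rw [hpre, Measure.prod_prod, Measure.infinitePi_pi _ fun i _ => ht i]
  split_ifs with hp
  · exact Finset.prod_erase_mul _ _ hp
  · rw [measure_univ, mul_one, Finset.erase_eq_of_notMem hp]

/-- Replacing one coordinate by an independent copy does not change a product measure. -/
lemma lintegral_infinitePi_update (ν : ∀ i, Measure (X i)) [∀ i, IsProbabilityMeasure (ν i)]
    (p : ι) {φ : (∀ i, X i) → ℝ≥0∞} (hφ : Measurable φ) :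
    ∫⁻ σ, φ σ ∂Measure.infinitePi ν =
      ∫⁻ σ, ∫⁻ s, φ (Function.update σ p s) ∂ν p ∂Measure.infinitePi ν := by
  have hmeas := measurable_update_prod (X := X) p
  conv_lhs => rw [← map_update_infinitePi ν p]
  rw [lintegral_map hφ hmeas]
  exact lintegral_prod _ (hφ.comp hmeas).aemeasurable

end Resampling

/-! ### The joint law of the clocks. -/

section SojournLaw

variable {A : ℕ}

/-- Positivity of the rates is carried as a `Fact`, so that the product measure of exponential laws
is found to be a probability measure by instance search. -/
instance isProbabilityMeasure_expMeasure_fact {ι : Type*} (r : ι → ℝ) [hr : Fact (∀ p, 0 < r p)]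
    (p : ι) : IsProbabilityMeasure (expMeasure (r p)) :=
  isProbabilityMeasure_expMeasure (hr.out p)

/-- The joint law of independent exponential sojourn times `σ (j, k)` with rates `r (j, k)`. -/
noncomputable def sojournLaw (r : Fin A × ℕ → ℝ) [Fact (∀ p, 0 < r p)] :
    Measure (Fin A × ℕ → ℝ) :=
  Measure.infinitePi fun p => expMeasure (r p)

variable (r : Fin A × ℕ → ℝ) [hr : Fact (∀ p, 0 < r p)]

instance : IsProbabilityMeasure (sojournLaw r) :=
  inferInstanceAs (IsProbabilityMeasure (Measure.infinitePi _))

lemma lintegral_sojournLaw_update (p : Fin A × ℕ) {φ : (Fin A × ℕ → ℝ) → ℝ≥0∞}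
    (hφ : Measurable φ) :
    ∫⁻ σ, φ σ ∂sojournLaw r =
      ∫⁻ σ, ∫⁻ s, φ (Function.update σ p s) ∂expMeasure (r p) ∂sojournLaw r :=
  lintegral_infinitePi_update _ p hφ

lemma sojournLaw_eq_lintegral_update (p : Fin A × ℕ) {S : Set (Fin A × ℕ → ℝ)}
    (hS : MeasurableSet S) :
    sojournLaw r S =
      ∫⁻ σ, expMeasure (r p) {s | Function.update σ p s ∈ S} ∂sojournLaw r := by
  rw [← lintegral_indicator_one hS, lintegral_sojournLaw_update r p (measurable_one.indicator hS)]
  refine lintegral_congr fun σ => ?_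
  have hm : MeasurableSet {s | Function.update σ p s ∈ S} :=
    hS.preimage (measurable_update σ)
  rw [← lintegral_indicator_one hm]
  rfl

/-- Tonelli in the other order: conditioning on the value `s` of a single clock, used when `s` is
the time of the first draw. -/
lemma sojournLaw_eq_lintegral_expMeasure (p : Fin A × ℕ) {S : Set (Fin A × ℕ → ℝ)}
    (hS : MeasurableSet S) :
    sojournLaw r S =
      ∫⁻ s, sojournLaw r {σ | Function.update σ p s ∈ S} ∂expMeasure (r p) := by
  have hmu := measurable_update_prod (X := fun _ : Fin A × ℕ => ℝ) p
  rw [← lintegral_indicator_one hS, lintegral_sojournLaw_update r p (measurable_one.indicator hS),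
    lintegral_lintegral_swap]
  · refine lintegral_congr fun s => ?_
    have hm : MeasurableSet {σ | Function.update σ p s ∈ S} :=
      hS.preimage (hmu.comp measurable_prodMk_right)
    rw [← lintegral_indicator_one hm]
    rfl
  · exact ((measurable_one.indicator hS).comp hmu).aemeasurable

lemma ae_pos_sojournLaw : ∀ᵐ σ ∂sojournLaw r, ∀ p, 0 < σ p :=
  ae_all_iff.2 fun p =>
    (measurePreserving_eval_infinitePi (fun p => expMeasure (r p)) p).quasiMeasurePreserving.ae
      (ae_pos_expMeasure (r p))

/-- A sojourn time almost surely differs from any function of the other sojourn times. -/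
lemma ae_ne_of_update_eq (p : Fin A × ℕ) {Z : (Fin A × ℕ → ℝ) → ℝ} (hZ : Measurable Z)
    (hp : ∀ σ s, Z (Function.update σ p s) = Z σ) : ∀ᵐ σ ∂sojournLaw r, σ p ≠ Z σ := by
  have hm : MeasurableSet {σ : Fin A × ℕ → ℝ | σ p = Z σ} :=
    measurableSet_eq_fun (measurable_pi_apply p) hZ
  have h : sojournLaw r {σ : Fin A × ℕ → ℝ | σ p = Z σ} = 0 := by
    rw [sojournLaw_eq_lintegral_update r p hm]
    refine (lintegral_congr fun σ => ?_).trans lintegral_zero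
    -- With the other coordinates frozen, the event pins the clock to one point, and the exponential
    -- law has no atoms.
    have : {s | Function.update σ p s ∈ {σ : Fin A × ℕ → ℝ | σ p = Z σ}} = {Z σ} := by
      ext s; simp [hp]
    rw [this, measure_singleton]
  simpa [ae_iff] using h

end SojournLaw

/-! ### Renewal of the clocks at the first draw. -/

section Shift

variable {A : ℕ}

/-- The event that colour `l` is drawn first. -/
def drawnFirst (l : Fin A) : Set (Fin A × ℕ → ℝ) :=
  {σ | ∀ j, j ≠ l → σ (l, 0) < σ (j, 0)}

/-- The sojourn times seen from the time of the first draw, if colour `l` is drawn first. -/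
def shiftTimes (l : Fin A) (σ : Fin A × ℕ → ℝ) : Fin A × ℕ → ℝ := fun p =>
  if p.1 = l then σ (l, p.2 + 1) else if p.2 = 0 then σ p - σ (l, 0) else σ p

/-- The rates after the first draw, if colour `l` is drawn first. -/
def shiftRates (l : Fin A) (r : Fin A × ℕ → ℝ) : Fin A × ℕ → ℝ := fun p =>
  if p.1 = l then r (l, p.2 + 1) else r p

instance (l : Fin A) (r : Fin A × ℕ → ℝ) [hr : Fact (∀ p, 0 < r p)] :
    Fact (∀ p, 0 < shiftRates l r p) :=
  ⟨fun p => by unfold shiftRates; split_ifs <;> exact hr.out _⟩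

lemma measurableSet_drawnFirst (l : Fin A) : MeasurableSet (drawnFirst l) := by
  simp only [drawnFirst, Set.ofPred_forall]
  exact MeasurableSet.iInter fun j => MeasurableSet.iInter fun _ =>
    measurableSet_lt (measurable_pi_apply _) (measurable_pi_apply _)

lemma measurable_shiftTimes (l : Fin A) : Measurable (shiftTimes l) := by
  refine measurable_pi_iff.2 fun p => ?_
  unfold shiftTimes
  split_ifs <;> fun_prop

variable (r : Fin A × ℕ → ℝ) [hr : Fact (∀ p, 0 < r p)]

/-- Given that clock `(l, 0)` rings at time `s`, the event is again a box. Each other first clock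
must exceed `s` with its residual in the prescribed set, which by memorylessness costs `exp (-(r (j,
0) * s))`; integrating the product of these factors over `s` gives the draw probability. -/
lemma sojournLaw_drawnFirst_inter_box (l : Fin A) (K : ℕ) {t : Fin A × ℕ → Set ℝ}
    (ht : ∀ p, MeasurableSet (t p)) :
    sojournLaw r (drawnFirst l ∩ shiftTimes l ⁻¹'
        Set.pi (Finset.univ ×ˢ Finset.range (K + 1) : Finset (Fin A × ℕ)) t) =
      ENNReal.ofReal (r (l, 0) / ∑ j, r (j, 0)) *
        ∏ p ∈ (Finset.univ ×ˢ Finset.range (K + 1) : Finset (Fin A × ℕ)),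
          expMeasure (shiftRates l r p) (t p) := by
  have hbox : MeasurableSet (Set.pi (Finset.univ ×ˢ Finset.range (K + 1) : Finset (Fin A × ℕ)) t) :=
    MeasurableSet.pi (Finset.countable_toSet _) fun p _ => ht p
  rw [sojournLaw_eq_lintegral_expMeasure r (l, 0)
    ((measurableSet_drawnFirst l).inter (hbox.preimage (measurable_shiftTimes l)))]
  -- The row of `l` is shifted by one, so it occupies columns `1` to `K + 1`. The other rows get a
  -- free column `K + 1` to complete the rectangle, and `(l, 0)` is free because its value has been
  -- replaced by `s`.
  let u : ℝ → Fin A × ℕ → Set ℝ := fun s p =>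
    if p.1 = l then (if p.2 = 0 then Set.univ else t (l, p.2 - 1))
    else if p.2 = 0 then {v | s < v ∧ v - s ∈ t p}
    else if p.2 = K + 1 then Set.univ else t p
  have hu : ∀ s p, MeasurableSet (u s p) := by
    intro s p
    simp only [u]
    split_ifs
    · exact MeasurableSet.univ
    · exact ht _
    · exact measurableSet_Ioi.inter ((ht p).preimage (measurable_id.sub_const s))
    · exact MeasurableSet.univ
    · exact ht _
  have hset : ∀ s, {σ : Fin A × ℕ → ℝ | Function.update σ (l, 0) s ∈ drawnFirst l ∩
      shiftTimes l ⁻¹' Set.pi (Finset.univ ×ˢ Finset.range (K + 1) : Finset (Fin A × ℕ)) t} =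
      Set.pi (Finset.univ ×ˢ Finset.range (K + 2) : Finset (Fin A × ℕ)) (u s) := by
    intro s
    ext σ
    simp only [Set.mem_ofPred_eq, Set.mem_inter_iff, drawnFirst, Set.mem_preimage, Set.mem_pi,
      Finset.mem_coe, Finset.mem_product, Finset.mem_univ, true_and, Finset.mem_range,
      Function.update_self]
    constructor
    · rintro ⟨h1, h2⟩ ⟨j, k⟩ hk
      simp only at hk
      simp only [u]
      by_cases hj : j = l
      · subst hj
        rcases k with _ | k
        · simp
        · simpa [shiftTimes] using h2 (j, k) (by simpa using hk)
      · rcases k with _ | k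
        · have a1 := h1 j hj
          have a2 := h2 (j, 0) (by simp)
          simpa [shiftTimes, hj] using And.intro a1 a2
        · by_cases hK : k = K
          · simp [hj, hK]
          · have a2 := h2 (j, k + 1) (by simp only; omega)
            simpa [shiftTimes, hj, hK] using a2
    · intro h
      refine ⟨fun j hj => ?_, ?_⟩
      · have := h (j, 0) (by simp)
        simp only [u, if_neg hj, if_true] at this
        simpa [hj] using this.1
      · rintro ⟨j, k⟩ hk
        simp only at hk
        by_cases hj : j = l
        · subst hj
          have := h (j, k + 1) (by simp only; omega)
          simpa [shiftTimes, u] using this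
        · rcases k with _ | k
          · have := h (j, 0) (by simp)
            simp only [u, if_neg hj, if_true] at this
            simpa [shiftTimes, hj] using this.2
          · have := h (j, k + 1) (by simp only; omega)
            have hK : k ≠ K := by omega
            simpa [shiftTimes, u, hj, hK] using this
  have hprod : ∀ s, 0 ≤ s →
      ∏ p ∈ (Finset.univ ×ˢ Finset.range (K + 2) : Finset (Fin A × ℕ)), expMeasure (r p) (u s p) =
      ENNReal.ofReal (Real.exp (-((∑ j ∈ Finset.univ.erase l, r (j, 0)) * s))) *
        ∏ p ∈ (Finset.univ ×ˢ Finset.range (K + 1) : Finset (Fin A × ℕ)),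
          expMeasure (shiftRates l r p) (t p) := by
    intro s hs
    have hexp : ENNReal.ofReal (Real.exp (-((∑ j ∈ Finset.univ.erase l, r (j, 0)) * s))) =
        ∏ j, if j = l then 1 else ENNReal.ofReal (Real.exp (-(r (j, 0) * s))) := by
      rw [Finset.sum_mul, ← Finset.sum_neg_distrib, Real.exp_sum,
        ENNReal.ofReal_prod_of_nonneg fun _ _ => (Real.exp_pos _).le,
        ← Finset.mul_prod_erase _ _ (Finset.mem_univ l), if_pos rfl, one_mul]
      exact Finset.prod_congr rfl fun j hj => by rw [if_neg (Finset.ne_of_mem_erase hj)]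
    rw [Finset.prod_product, Finset.prod_product, hexp, ← Finset.prod_mul_distrib]
    refine Finset.prod_congr rfl fun j _ => ?_
    by_cases hj : j = l
    · subst hj
      rw [Finset.prod_range_succ']
      simp [u, shiftRates]
    · rw [Finset.prod_range_succ, Finset.prod_range_succ' (n := K), Finset.prod_range_succ' (n := K),
        if_neg hj]
      have h0 : expMeasure (r (j, 0)) (u s (j, 0)) =
          ENNReal.ofReal (Real.exp (-(r (j, 0) * s))) * expMeasure (r (j, 0)) (t (j, 0)) := by
        rw [← expMeasure_memoryless _ hs (ht _)]
        simp [u, hj]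
      have h1 : expMeasure (r (j, K + 1)) (u s (j, K + 1)) = 1 := by
        simp [u, hj]
      have h2 : ∀ k ∈ Finset.range K, expMeasure (r (j, k + 1)) (u s (j, k + 1)) =
          expMeasure (shiftRates l r (j, k + 1)) (t (j, k + 1)) := by
        intro k hk
        have : k ≠ K := (Finset.mem_range.1 hk).ne
        simp [u, hj, shiftRates, this]
      have h3 : shiftRates l r (j, 0) = r (j, 0) := by simp [shiftRates, hj]
      rw [h0, h1, Finset.prod_congr rfl h2, h3]
      ring
  have key : ∀ᵐ s ∂expMeasure (r (l, 0)), sojournLaw r {σ : Fin A × ℕ → ℝ |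
      Function.update σ (l, 0) s ∈ drawnFirst l ∩
      shiftTimes l ⁻¹' Set.pi (Finset.univ ×ˢ Finset.range (K + 1) : Finset (Fin A × ℕ)) t} =
      ENNReal.ofReal (Real.exp (-((∑ j ∈ Finset.univ.erase l, r (j, 0)) * s))) *
        ∏ p ∈ (Finset.univ ×ˢ Finset.range (K + 1) : Finset (Fin A × ℕ)),
          expMeasure (shiftRates l r p) (t p) := by
    filter_upwards [ae_pos_expMeasure (r (l, 0))] with s hs
    rw [hset, ← hprod s hs.le]
    exact Measure.infinitePi_pi _ fun p _ => hu s p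
  rw [lintegral_congr_ae key, lintegral_mul_const _ (by fun_prop), lintegral_exp_neg_expMeasure
    (hr.out _) (Finset.sum_nonneg fun j _ => (hr.out _).le),
    Finset.add_sum_erase _ (fun j => r (j, 0)) (Finset.mem_univ l)]

/-- After division by the draw probability, the left side agrees with the product law on all finite
boxes, which determines it. Boxes over arbitrary finite sets of coordinates are filled up to full
rectangles with unconstrained factors. -/
lemma map_shiftTimes_restrict_drawnFirst (l : Fin A) :
    ((sojournLaw r).restrict (drawnFirst l)).map (shiftTimes l) =
      ENNReal.ofReal (r (l, 0) / ∑ j, r (j, 0)) • sojournLaw (shiftRates l r) := by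
  have hpos : 0 < r (l, 0) / ∑ j, r (j, 0) :=
    div_pos (hr.out _) (Finset.sum_pos (fun j _ => hr.out _) ⟨l, Finset.mem_univ l⟩)
  set c := ENNReal.ofReal (r (l, 0) / ∑ j, r (j, 0)) with hc
  have hc0 : c ≠ 0 := (ENNReal.ofReal_pos.2 hpos).ne'
  have hct : c ≠ ∞ := ENNReal.ofReal_ne_top
  have h : c⁻¹ • ((sojournLaw r).restrict (drawnFirst l)).map (shiftTimes l) =
      sojournLaw (shiftRates l r) := by
    refine Measure.eq_infinitePi _ fun s t ht => ?_
    obtain ⟨K, hK⟩ : ∃ K, ∀ p ∈ s, p.2 < K + 1 :=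
      ⟨s.sup Prod.snd, fun p hp => Nat.lt_succ_of_le (Finset.le_sup (f := Prod.snd) hp)⟩
    let t' : Fin A × ℕ → Set ℝ := fun p => if p ∈ s then t p else Set.univ
    have ht' : ∀ p, MeasurableSet (t' p) := fun p => by
      simp only [t']; split_ifs; exacts [ht p, MeasurableSet.univ]
    have hsub : s ⊆ (Finset.univ ×ˢ Finset.range (K + 1) : Finset (Fin A × ℕ)) := fun p hp =>
      Finset.mem_product.2 ⟨Finset.mem_univ _, Finset.mem_range.2 (hK p hp)⟩
    have hpi : Set.pi s t =
        Set.pi (Finset.univ ×ˢ Finset.range (K + 1) : Finset (Fin A × ℕ)) t' := by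
      ext σ
      simp only [Set.mem_pi, Finset.mem_coe, t']
      constructor
      · intro h p _
        split_ifs with hp
        exacts [h p hp, trivial]
      · intro h p hp
        simpa [hp] using h p (hsub hp)
    have hm : MeasurableSet (Set.pi (s : Set (Fin A × ℕ)) t) :=
      MeasurableSet.pi (Finset.countable_toSet _) fun p _ => ht p
    rw [Measure.smul_apply, Measure.map_apply (measurable_shiftTimes l) hm,
      Measure.restrict_apply (hm.preimage (measurable_shiftTimes l)), Set.inter_comm, hpi,
      sojournLaw_drawnFirst_inter_box r l K ht', smul_eq_mul, ← mul_assoc,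
      ENNReal.inv_mul_cancel hc0 hct, one_mul]
    rw [← Finset.prod_subset hsub]
    · exact Finset.prod_congr rfl fun p hp => by simp [t', hp]
    · intro p _ hp
      simp [t', hp]
  rw [← h, smul_smul, ENNReal.mul_inv_cancel hc0 hct, one_smul]

lemma sojournLaw_drawnFirst_inter (l : Fin A) {S : Set (Fin A × ℕ → ℝ)} (hS : MeasurableSet S) :
    sojournLaw r (drawnFirst l ∩ shiftTimes l ⁻¹' S) =
      ENNReal.ofReal (r (l, 0) / ∑ j, r (j, 0)) * sojournLaw (shiftRates l r) S := by
  rw [Set.inter_comm, ← Measure.restrict_apply (hS.preimage (measurable_shiftTimes l)),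
    ← Measure.map_apply (measurable_shiftTimes l) hS, map_shiftTimes_restrict_drawnFirst]
  rfl

lemma ae_mem_iUnion_drawnFirst [Nonempty (Fin A)] :
    ∀ᵐ σ ∂sojournLaw r, ∃ l, σ ∈ drawnFirst l := by
  have h : ∀ᵐ σ ∂sojournLaw r, ∀ j l : Fin A, j ≠ l → σ (j, 0) ≠ σ (l, 0) := by
    refine ae_all_iff.2 fun j => ae_all_iff.2 fun l => ?_
    by_cases hjl : j = l
    · simp [hjl]
    · filter_upwards [ae_ne_of_update_eq r (j, 0) (measurable_pi_apply (l, 0)) fun σ s => by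
        simp [Function.update_of_ne, Ne.symm hjl]] with σ hσ _ using hσ
  filter_upwards [h] with σ hσ
  obtain ⟨l, hl⟩ := Finite.exists_min fun j => σ (j, 0)
  exact ⟨l, fun j hj => lt_of_le_of_ne (hl j) (hσ l j hj.symm)⟩

lemma disjoint_drawnFirst : Pairwise (Function.onFun Disjoint (drawnFirst (A := A))) := by
  intro l m hlm
  refine Set.disjoint_left.2 fun σ h1 h2 => ?_
  exact lt_asymm (h1 m hlm.symm) (h2 l hlm)

/-- Decomposition according to the colour that is drawn first. -/
lemma sojournLaw_eq_sum_drawnFirst [Nonempty (Fin A)] {S : Set (Fin A × ℕ → ℝ)}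
    (hS : MeasurableSet S) :
    sojournLaw r S = ∑ l, sojournLaw r (S ∩ drawnFirst l) := by
  rw [← tsum_fintype (L := .unconditional _), ← measure_iUnion
    (fun l m hlm => (disjoint_drawnFirst hlm).mono Set.inter_subset_right Set.inter_subset_right)
    (fun l => hS.inter (measurableSet_drawnFirst l)), ← Set.inter_iUnion]
  refine measure_congr ?_
  filter_upwards [ae_mem_iUnion_drawnFirst r] with σ hσ
  refine propext ⟨fun h => ⟨h, Set.mem_iUnion.2 hσ⟩, fun h => h.1⟩

end Shift

/-! ### The number of draws of one colour, read off from the clocks. -/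

section Reach

variable {A : ℕ}

/-- The time at which the `m`-th ball of colour `j` is added. -/
def hitTime (j : Fin A) (m : ℕ) (σ : Fin A × ℕ → ℝ) : ℝ := ∑ k ∈ Finset.range m, σ (j, k)

/-- The event that colour `i` is drawn at least `m` times within the first `n` draws: every other
colour `j` is drawn at most `k j` times before the `m`-th draw of `i`. -/
def reachEvent (n : ℕ) (i : Fin A) (m : ℕ) : Set (Fin A × ℕ → ℝ) :=
  {σ | ∃ k : Fin A → ℕ, k i = m ∧ ∑ j, k j ≤ n ∧ ∀ j, j ≠ i → hitTime i m σ < hitTime j (k j + 1) σ}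

@[fun_prop]
lemma measurable_hitTime (j : Fin A) (m : ℕ) : Measurable (hitTime j m) := by
  unfold hitTime; fun_prop

lemma hitTime_succ' (j : Fin A) (m : ℕ) (σ : Fin A × ℕ → ℝ) :
    hitTime j (m + 1) σ = ∑ k ∈ Finset.range m, σ (j, k + 1) + σ (j, 0) :=
  Finset.sum_range_succ' _ _

lemma hitTime_nonneg (j : Fin A) (m : ℕ) {σ : Fin A × ℕ → ℝ} (hσ : ∀ p, 0 < σ p) :
    0 ≤ hitTime j m σ := Finset.sum_nonneg fun _ _ => (hσ _).le

lemma hitTime_mono (j : Fin A) {σ : Fin A × ℕ → ℝ} (hσ : ∀ p, 0 < σ p) :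
    Monotone fun m => hitTime j m σ := fun _ _ h =>
  Finset.sum_le_sum_of_subset_of_nonneg (Finset.range_mono h) fun _ _ _ => (hσ _).le

lemma measurableSet_reachEvent (n : ℕ) (i : Fin A) (m : ℕ) :
    MeasurableSet (reachEvent n i m) := by
  simp only [reachEvent, Set.ofPred_exists, Set.ofPred_and, Set.ofPred_forall]
  refine MeasurableSet.iUnion fun k => (MeasurableSet.const _).inter ((MeasurableSet.const _).inter
    (MeasurableSet.iInter fun j => MeasurableSet.iInter fun _ => ?_))
  exact measurableSet_lt (measurable_hitTime _ _) (measurable_hitTime _ _)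

lemma monotone_reachEvent (i : Fin A) (m : ℕ) : Monotone fun n => reachEvent n i m :=
  fun _ _ h _ ⟨k, h1, h2, h3⟩ => ⟨k, h1, h2.trans h, h3⟩

lemma hitTime_shiftTimes_self (l : Fin A) (m : ℕ) (σ : Fin A × ℕ → ℝ) :
    hitTime l m (shiftTimes l σ) = hitTime l (m + 1) σ - σ (l, 0) := by
  rw [hitTime_succ', add_sub_cancel_right]
  exact Finset.sum_congr rfl fun k _ => by simp [shiftTimes]

lemma hitTime_shiftTimes_of_ne {j l : Fin A} (h : j ≠ l) (m : ℕ) (σ : Fin A × ℕ → ℝ) :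
    hitTime j (m + 1) (shiftTimes l σ) = hitTime j (m + 1) σ - σ (l, 0) := by
  rw [hitTime_succ', hitTime_succ', add_sub_assoc]
  congr 1
  · exact Finset.sum_congr rfl fun k _ => by simp [shiftTimes, h]
  · simp [shiftTimes, h]

/-- Restarting at the first draw subtracts the same amount `σ (l, 0)` from all arrival times, so
every comparison survives. The witness `k` changes by one in coordinate `l`, and the target `m + 1`
drops only if `i` itself was drawn. -/
lemma shiftTimes_mem_reachEvent {σ : Fin A × ℕ → ℝ} (hσ : ∀ p, 0 < σ p) {l : Fin A}
    (hl : σ ∈ drawnFirst l) (n : ℕ) (i : Fin A) (m : ℕ) :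
    shiftTimes l σ ∈ reachEvent n i (if l = i then m else m + 1) ↔
      σ ∈ reachEvent (n + 1) i (m + 1) := by
  have hi : hitTime i (if l = i then m else m + 1) (shiftTimes l σ) =
      hitTime i (m + 1) σ - σ (l, 0) := by
    split_ifs with h
    · subst h; exact hitTime_shiftTimes_self _ _ _
    · exact hitTime_shiftTimes_of_ne (Ne.symm h) _ _
  constructor
  · rintro ⟨k, h1, h2, h3⟩
    rw [hi] at h3
    refine ⟨k + Pi.single l 1, ?_, ?_, fun j hj => ?_⟩
    · rw [Pi.add_apply, h1]
      split_ifs with h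
      · simp [h]
      · simp [Pi.single_eq_of_ne (Ne.symm h)]
    · simpa [Finset.sum_add_distrib] using h2
    · have := h3 j hj
      by_cases hjl : j = l
      · subst hjl
        rw [hitTime_shiftTimes_self] at this
        simpa using this
      · rw [hitTime_shiftTimes_of_ne hjl] at this
        simpa [Pi.single_eq_of_ne hjl] using this
  · rintro ⟨k, h1, h2, h3⟩
    -- One draw of `l` has to be removed from `k`. If `k l = 0` with `l ≠ i`, colour `i` would
    -- arrive before the first arrival of `l`, against `drawnFirst l`.
    have hkl : 1 ≤ k l := by
      by_cases h : l = i
      · subst h; omega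
      · by_contra h0
        have h0 : k l = 0 := by omega
        have h4 := h3 l h
        have h5 : σ (i, 0) ≤ hitTime i (m + 1) σ := by
          have := hitTime_mono i hσ (show 1 ≤ m + 1 by omega)
          simpa [hitTime] using this
        have h6 := hl i (Ne.symm h)
        simp only [h0, zero_add] at h4
        simp only [hitTime, Finset.range_one, Finset.sum_singleton] at h4 h5
        linarith
    have hk : k = (k - Pi.single l 1) + Pi.single l 1 := by
      ext j
      by_cases h : j = l
      · subst h; simp; omega
      · simp [Pi.single_eq_of_ne h]
    generalize k - Pi.single l 1 = k' at hk
    subst hk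
    refine ⟨k', ?_, ?_, fun j hj => ?_⟩
    · by_cases h : l = i
      · subst h; simpa using h1
      · simpa [h, Pi.single_eq_of_ne (Ne.symm h)] using h1
    · simpa [Finset.sum_add_distrib] using h2
    · rw [hi]
      have := h3 j hj
      by_cases hjl : j = l
      · subst hjl
        rw [hitTime_shiftTimes_self]
        simpa using this
      · rw [hitTime_shiftTimes_of_ne hjl]
        simpa [Pi.single_eq_of_ne hjl] using this

variable (r : Fin A × ℕ → ℝ) [hr : Fact (∀ p, 0 < r p)]

lemma sojournLaw_reachEvent_succ (n : ℕ) (i : Fin A) (m : ℕ) :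
    sojournLaw r (reachEvent (n + 1) i (m + 1)) =
      ∑ l, ENNReal.ofReal (r (l, 0) / ∑ j, r (j, 0)) *
        sojournLaw (shiftRates l r) (reachEvent n i (if l = i then m else m + 1)) := by
  have : Nonempty (Fin A) := ⟨i⟩
  rw [sojournLaw_eq_sum_drawnFirst r (measurableSet_reachEvent _ _ _)]
  refine Finset.sum_congr rfl fun l _ => ?_
  rw [← sojournLaw_drawnFirst_inter r l (measurableSet_reachEvent _ _ _)]
  refine measure_congr ?_
  filter_upwards [ae_pos_sojournLaw r] with σ hσ
  refine propext ⟨fun h => ⟨h.2, ?_⟩, fun h => ⟨?_, h.1⟩⟩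
  · exact (shiftTimes_mem_reachEvent hσ h.2 n i m).2 h.1
  · exact (shiftTimes_mem_reachEvent hσ h.1 n i m).1 h.2

lemma sojournLaw_reachEvent_zero (n : ℕ) (i : Fin A) : sojournLaw r (reachEvent n i 0) = 1 := by
  rw [← mem_ae_iff_prob_eq_one (measurableSet_reachEvent _ _ _)]
  filter_upwards [ae_pos_sojournLaw r] with σ hσ
  exact ⟨0, rfl, by simp, fun j _ => by simpa [hitTime] using hσ _⟩

lemma reachEvent_zero_succ (i : Fin A) (m : ℕ) : reachEvent 0 i (m + 1) = ∅ := by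
  refine Set.eq_empty_of_forall_notMem fun σ ⟨k, h1, h2, _⟩ => ?_
  have := Finset.single_le_sum (f := k) (fun j _ => Nat.zero_le _) (Finset.mem_univ i)
  omega

/-- The explosion time of colour `j`. -/
noncomputable def totalTime (j : Fin A) (σ : Fin A × ℕ → ℝ) : ℝ≥0∞ :=
  ∑' k, ENNReal.ofReal (σ (j, k))

/-- The first explosion time among the colours other than `i`. -/
noncomputable def minTotal (i : Fin A) (σ : Fin A × ℕ → ℝ) : ℝ≥0∞ :=
  ⨅ j : {j : Fin A // j ≠ i}, totalTime j σ

@[fun_prop]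
lemma measurable_totalTime (j : Fin A) : Measurable (totalTime j) := by
  unfold totalTime; fun_prop

@[fun_prop]
lemma measurable_minTotal (i : Fin A) : Measurable (minTotal i) := by
  unfold minTotal; fun_prop

lemma lt_minTotal_iff {i : Fin A} {σ : Fin A × ℕ → ℝ} {a : ℝ≥0∞} (ha : a ≠ ∞) :
    a < minTotal i σ ↔ ∀ j, j ≠ i → a < totalTime j σ := by
  constructor
  · exact fun h j hj =>
      h.trans_le (iInf_le (fun j : {j : Fin A // j ≠ i} => totalTime j.1 σ) ⟨j, hj⟩)
  · intro h
    rcases isEmpty_or_nonempty {j : Fin A // j ≠ i} with he | he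
    · rw [minTotal, iInf_of_empty]; exact lt_top_iff_ne_top.2 ha
    · obtain ⟨j, hj⟩ := exists_eq_ciInf_of_finite
        (f := fun j : {j : Fin A // j ≠ i} => totalTime j.1 σ)
      rw [minTotal, ← hj]
      exact h j j.2

lemma ofReal_hitTime (j : Fin A) (m : ℕ) {σ : Fin A × ℕ → ℝ} (hσ : ∀ p, 0 < σ p) :
    ENNReal.ofReal (hitTime j m σ) = ∑ k ∈ Finset.range m, ENNReal.ofReal (σ (j, k)) :=
  ENNReal.ofReal_sum_of_nonneg fun _ _ => (hσ _).le

lemma totalTime_eq_iSup (j : Fin A) {σ : Fin A × ℕ → ℝ} (hσ : ∀ p, 0 < σ p) :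
    totalTime j σ = ⨆ m, ENNReal.ofReal (hitTime j m σ) := by
  simp_rw [totalTime, ENNReal.tsum_eq_iSup_nat, ofReal_hitTime j _ hσ]

/-- With no bound on the number of draws, the requirement is only that each other colour has made
finitely many draws by the arrival time. As `totalTime` is the supremum of the arrival times, this
says that none of the others has exploded by then. -/
lemma mem_iUnion_reachEvent {σ : Fin A × ℕ → ℝ} (hσ : ∀ p, 0 < σ p) (i : Fin A) (m : ℕ) :
    σ ∈ ⋃ n, reachEvent n i m ↔ ENNReal.ofReal (hitTime i m σ) < minTotal i σ := by
  rw [lt_minTotal_iff ENNReal.ofReal_ne_top, Set.mem_iUnion]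
  have hs := hitTime_nonneg i m hσ
  constructor
  · rintro ⟨n, k, h1, h2, h3⟩ j hj
    rw [totalTime_eq_iSup j hσ]
    exact lt_iSup_iff.2 ⟨k j + 1, (ENNReal.ofReal_lt_ofReal_iff_of_nonneg hs).2 (h3 j hj)⟩
  · intro h
    have : ∀ j, ∃ k, j ≠ i → hitTime i m σ < hitTime j (k + 1) σ := by
      intro j
      by_cases hj : j = i
      · exact ⟨0, fun h => (h hj).elim⟩
      · have hj' := h j hj
        rw [totalTime_eq_iSup j hσ] at hj'
        obtain ⟨k, hk⟩ := lt_iSup_iff.1 hj'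
        rw [ENNReal.ofReal_lt_ofReal_iff_of_nonneg hs] at hk
        exact ⟨k, fun _ => hk.trans_le (hitTime_mono j hσ (Nat.le_succ k))⟩
    choose k hk using this
    refine ⟨∑ j, Function.update k i m j, Function.update k i m, by simp, le_rfl, fun j hj => ?_⟩
    rw [Function.update_of_ne hj]
    exact hk j hj

lemma tendsto_sojournLaw_reachEvent (i : Fin A) (m : ℕ) :
    Tendsto (fun n => sojournLaw r (reachEvent n i m)) atTop
      (𝓝 (sojournLaw r {σ | ENNReal.ofReal (hitTime i m σ) < minTotal i σ})) := by
  have h : sojournLaw r {σ | ENNReal.ofReal (hitTime i m σ) < minTotal i σ} =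
      sojournLaw r (⋃ n, reachEvent n i m) := by
    refine measure_congr ?_
    filter_upwards [ae_pos_sojournLaw r] with σ hσ
    exact propext (mem_iUnion_reachEvent hσ i m).symm
  rw [h]
  exact tendsto_measure_iUnion_atTop (monotone_reachEvent i m)

end Reach

lemma coe_le_finalCount {A : ℕ} {Ω : Type*} {X : ℕ → Ω → Fin A → ℕ} {i : Fin A} {ω : Ω} {c : ℕ} :
    (c : ℕ∞) ≤ finalCount X i ω ↔ ∃ n, c ≤ X n ω i := by
  constructor
  · intro h
    rcases c with _ | c
    · exact ⟨0, Nat.zero_le _⟩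
    · have h' : (c : ℕ∞) < finalCount X i ω := lt_of_lt_of_le (by exact_mod_cast Nat.lt_succ_self c) h
      obtain ⟨n, hn⟩ := lt_iSup_iff.1 h'
      exact ⟨n, by exact_mod_cast hn⟩
  · rintro ⟨n, hn⟩
    exact le_trans (by exact_mod_cast hn) (le_iSup (fun n => (X n ω i : ℕ∞)) n)

/-! ### Identification of the urn with the birth processes. -/

section Urn

variable {A : ℕ} {Ω : Type*} [MeasurableSpace Ω] {μ : Measure Ω}
  {F : Fin A → ℕ → ℝ} {x₀ : Fin A → ℕ} {X : ℕ → Ω → Fin A → ℕ}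

/-- The rates of the sojourn times of the birth processes started from `x` (set to `1` where `F`
is not positive). -/
noncomputable def rateAt (F : Fin A → ℕ → ℝ) (x : Fin A → ℕ) (p : Fin A × ℕ) : ℝ :=
  if 0 < F p.1 (x p.1 + p.2) then F p.1 (x p.1 + p.2) else 1

instance (F : Fin A → ℕ → ℝ) (x : Fin A → ℕ) : Fact (∀ p, 0 < rateAt F x p) :=
  ⟨fun p => by unfold rateAt; split_ifs with h; exacts [h, one_pos]⟩

lemma rateAt_eq (hF : ∀ j k, 1 ≤ k → 0 < F j k) {x : Fin A → ℕ} (hx : ∀ j, 1 ≤ x j)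
    (p : Fin A × ℕ) : rateAt F x p = F p.1 (x p.1 + p.2) :=
  if_pos (hF _ _ (by have := hx p.1; omega))

lemma shiftRates_rateAt (F : Fin A → ℕ → ℝ) (x : Fin A → ℕ) (l : Fin A) :
    shiftRates l (rateAt F x) = rateAt F (x + Pi.single l 1) := by
  ext ⟨j, k⟩
  by_cases h : j = l
  · subst h
    simp [shiftRates, rateAt, add_assoc, add_comm k 1]
  · simp [shiftRates, rateAt, h]

/-- The probability that colour `l` is drawn from the configuration `x`. -/
noncomputable def drawProb (F : Fin A → ℕ → ℝ) (x : Fin A → ℕ) (l : Fin A) : ℝ≥0∞ :=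
  ENNReal.ofReal (F l (x l) / ∑ j, F j (x j))

lemma sum_drawProb [Nonempty (Fin A)] (hF : ∀ j k, 1 ≤ k → 0 < F j k) {x : Fin A → ℕ}
    (hx : ∀ j, 1 ≤ x j) : ∑ l, drawProb F x l = 1 := by
  have hpos : 0 < ∑ j, F j (x j) :=
    Finset.sum_pos (fun j _ => hF j _ (hx j)) Finset.univ_nonempty
  simp_rw [drawProb]
  rw [← ENNReal.ofReal_sum_of_nonneg fun j _ => div_nonneg (hF j _ (hx j)).le hpos.le,
    ← Finset.sum_div, div_self hpos.ne', ENNReal.ofReal_one]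

/-- The Markov property in terms of the present state alone, obtained by summing `IsUrn.step` over
the countably many pasts that end in `z`. -/
lemma IsUrn.measure_step (hX : IsUrn F x₀ X μ) (n : ℕ) (z : Fin A → ℕ) (l : Fin A) :
    μ {ω | X n ω = z ∧ X (n + 1) ω = X n ω + Pi.single l 1} =
      drawProb F z l * μ {ω | X n ω = z} := by
  let y : (Fin n → Fin A → ℕ) → ℕ → Fin A → ℕ := fun w m => if h : m < n then w ⟨m, h⟩ else z
  have hy : ∀ w ω, (∀ m ≤ n, X m ω = y w m) ↔ X n ω = z ∧ w = fun m : Fin n => X m ω := by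
    intro w ω
    constructor
    · intro h
      refine ⟨by simpa [y] using h n le_rfl, funext fun m => ?_⟩
      have := h m m.2.le
      simpa [y] using this.symm
    · rintro ⟨h, rfl⟩ m hm
      simp only [y]
      split_ifs with hmn
      · rfl
      · rw [show m = n by omega, h]
  have hmeas : ∀ w, MeasurableSet {ω | ∀ m ≤ n, X m ω = y w m} := by
    intro w
    simp only [Set.ofPred_forall]
    exact MeasurableSet.iInter fun m => MeasurableSet.iInter fun _ =>
      hX.measurable m (measurableSet_singleton _)
  have hstep : MeasurableSet {ω | X (n + 1) ω = X n ω + Pi.single l 1} :=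
    measurableSet_eq_fun (hX.measurable _) ((hX.measurable n).add_const _)
  have h1 : {ω | X n ω = z} = ⋃ w, {ω | ∀ m ≤ n, X m ω = y w m} := by
    ext ω; simp [hy]
  have h2 : {ω | X n ω = z ∧ X (n + 1) ω = X n ω + Pi.single l 1} =
      ⋃ w, {ω | (∀ m ≤ n, X m ω = y w m) ∧ X (n + 1) ω = X n ω + Pi.single l 1} := by
    ext ω; simp [hy]
  have hd : Pairwise (Function.onFun Disjoint fun w => {ω | ∀ m ≤ n, X m ω = y w m}) := by
    intro w w' hw
    refine Set.disjoint_left.2 fun ω h h' => hw ?_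
    rw [((hy _ _).1 h).2, ((hy _ _).1 h').2]
  rw [h1, h2, measure_iUnion hd hmeas, measure_iUnion, ← ENNReal.tsum_mul_left]
  · refine tsum_congr fun w => ?_
    rw [hX.step n (y w) l]
    simp [y, drawProb]
  · exact fun w w' hw => (hd hw).mono (fun ω h => h.1) fun ω h => h.1
  · exact fun w => (hmeas w).inter hstep

lemma IsUrn.measurableSet_le_finalCount (hX : IsUrn F x₀ X μ) (i : Fin A) (c : ℕ) :
    MeasurableSet {ω | (c : ℕ∞) ≤ finalCount X i ω} := by
  simp only [coe_le_finalCount, Set.ofPred_exists]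
  exact MeasurableSet.iUnion fun n =>
    measurableSet_le measurable_const ((measurable_pi_apply i).comp (hX.measurable n))

lemma IsUrn.setLIntegral_step (hX : IsUrn F x₀ X μ) (n : ℕ) (l : Fin A)
    (g : (Fin A → ℕ) → ℝ≥0∞) :
    ∫⁻ ω in {ω | X (n + 1) ω = X n ω + Pi.single l 1}, g (X n ω) ∂μ =
      ∫⁻ ω, drawProb F (X n ω) l * g (X n ω) ∂μ := by
  have hg : ∀ g : (Fin A → ℕ) → ℝ≥0∞, Measurable g := fun g => measurable_of_countable g
  have hmap : (μ.restrict {ω | X (n + 1) ω = X n ω + Pi.single l 1}).map (X n) =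
      (μ.map (X n)).withDensity fun z => drawProb F z l := by
    refine Measure.ext_of_singleton fun z => ?_
    rw [Measure.map_apply (hX.measurable n) (measurableSet_singleton z),
      Measure.restrict_apply (hX.measurable n (measurableSet_singleton z)),
      withDensity_apply _ (measurableSet_singleton z), lintegral_singleton,
      Measure.map_apply (hX.measurable n) (measurableSet_singleton z)]
    exact hX.measure_step n z l
  rw [← lintegral_map (hg g) (hX.measurable n), hmap, lintegral_withDensity_eq_lintegral_mul _
    (hg _) (hg g), lintegral_map (hg _) (hX.measurable n)]
  rfl

variable [IsProbabilityMeasure μ]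

/-- `IsUrn.step` prescribes only the probabilities of adding one ball; that nothing else can happen
follows because they sum to one. This needs positive counts, since `F` is controlled only from `1`
on; `IsUrn.ae_pos` provides them by an induction that uses this lemma. -/
lemma IsUrn.ae_step_of_ae_ge (hX : IsUrn F x₀ X μ) [Nonempty (Fin A)]
    (hF : ∀ j k, 1 ≤ k → 0 < F j k) {n : ℕ} (hn : ∀ᵐ ω ∂μ, ∀ j, 1 ≤ X n ω j) :
    ∀ᵐ ω ∂μ, ∃ l, X (n + 1) ω = X n ω + Pi.single l 1 := by
  have h : ∀ z : Fin A → ℕ, (∀ j, 1 ≤ z j) →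
      ∀ᵐ ω ∂μ, X n ω = z → ∃ l, X (n + 1) ω = X n ω + Pi.single l 1 := by
    intro z hz
    have hm : ∀ l, MeasurableSet {ω | X n ω = z ∧ X (n + 1) ω = X n ω + Pi.single l 1} := fun l =>
      (hX.measurable n (measurableSet_singleton z)).inter
        (measurableSet_eq_fun (hX.measurable _) ((hX.measurable n).add_const _))
    have hU : μ (⋃ l, {ω | X n ω = z ∧ X (n + 1) ω = X n ω + Pi.single l 1}) = μ {ω | X n ω = z} := by
      rw [measure_iUnion _ hm, tsum_fintype]
      · simp_rw [hX.measure_step]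
        rw [← Finset.sum_mul, sum_drawProb hF hz, one_mul]
      · intro l l' hl
        refine Set.disjoint_left.2 fun ω h h' => hl ?_
        have h3 := add_left_cancel (h.2.symm.trans h'.2)
        by_contra hne
        have := congrFun h3 l
        simp [Pi.single_eq_of_ne hne] at this
    have hsub : (⋃ l, {ω | X n ω = z ∧ X (n + 1) ω = X n ω + Pi.single l 1}) ⊆ {ω | X n ω = z} :=
      Set.iUnion_subset fun l ω h => h.1
    have hdiff := measure_sdiff hsub (MeasurableSet.iUnion hm).nullMeasurableSet (measure_ne_top μ _)
    rw [hU, tsub_self] at hdiff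
    refine measure_mono_null (fun ω hω => ?_) hdiff
    simp only [Set.mem_compl_iff, Set.mem_ofPred_eq, not_forall] at hω
    obtain ⟨h1, h2⟩ := hω
    refine ⟨h1, fun h3 => h2 ?_⟩
    obtain ⟨l, hl⟩ := Set.mem_iUnion.1 h3
    exact ⟨l, hl.2⟩
  have h' : ∀ᵐ ω ∂μ, ∀ z : {z : Fin A → ℕ // ∀ j, 1 ≤ z j},
      X n ω = z → ∃ l, X (n + 1) ω = X n ω + Pi.single l 1 := ae_all_iff.2 fun z => h z z.2
  filter_upwards [hn, h'] with ω h1 h2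
  exact h2 ⟨X n ω, h1⟩ rfl

lemma IsUrn.ae_pos (hX : IsUrn F x₀ X μ) [Nonempty (Fin A)] (hF : ∀ j k, 1 ≤ k → 0 < F j k)
    (hx₀ : ∀ j, 1 ≤ x₀ j) (n : ℕ) : ∀ᵐ ω ∂μ, ∀ j, 1 ≤ X n ω j := by
  induction n with
  | zero => filter_upwards [hX.init] with ω h j; rw [h]; exact hx₀ j
  | succ n ih =>
    filter_upwards [ih, hX.ae_step_of_ae_ge hF ih] with ω h1 ⟨l, hl⟩ j
    rw [hl, Pi.add_apply]
    exact le_add_right (h1 j)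

lemma IsUrn.ae_step (hX : IsUrn F x₀ X μ) [Nonempty (Fin A)] (hF : ∀ j k, 1 ≤ k → 0 < F j k)
    (hx₀ : ∀ j, 1 ≤ x₀ j) : ∀ᵐ ω ∂μ, ∀ n, ∃ l, X (n + 1) ω = X n ω + Pi.single l 1 :=
  ae_all_iff.2 fun n => hX.ae_step_of_ae_ge hF (hX.ae_pos hF hx₀ n)

lemma IsUrn.ae_monotone (hX : IsUrn F x₀ X μ) [Nonempty (Fin A)] (hF : ∀ j k, 1 ≤ k → 0 < F j k)
    (hx₀ : ∀ j, 1 ≤ x₀ j) : ∀ᵐ ω ∂μ, Monotone fun n => X n ω := by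
  filter_upwards [hX.ae_step hF hx₀] with ω h
  refine monotone_nat_of_le_succ fun n => ?_
  obtain ⟨l, hl⟩ := h n
  rw [hl]
  exact le_self_add

lemma IsUrn.lintegral_step (hX : IsUrn F x₀ X μ) [Nonempty (Fin A)]
    (hF : ∀ j k, 1 ≤ k → 0 < F j k) (hx₀ : ∀ j, 1 ≤ x₀ j) (n : ℕ) (g : (Fin A → ℕ) → ℝ≥0∞) :
    ∫⁻ ω, ∑ l, drawProb F (X n ω) l * g (X n ω + Pi.single l 1) ∂μ = ∫⁻ ω, g (X (n + 1) ω) ∂μ := by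
  have hm : ∀ g : (Fin A → ℕ) → ℝ≥0∞, Measurable fun ω => g (X n ω) := fun g =>
    (measurable_of_countable g).comp (hX.measurable n)
  have hs : ∀ l, MeasurableSet {ω | X (n + 1) ω = X n ω + Pi.single l 1} := fun l =>
    measurableSet_eq_fun (hX.measurable _) ((hX.measurable n).add_const _)
  have hsum : ∫⁻ ω, ∑ l, drawProb F (X n ω) l * g (X n ω + Pi.single l 1) ∂μ =
      ∑ l, ∫⁻ ω, drawProb F (X n ω) l * g (X n ω + Pi.single l 1) ∂μ :=
    lintegral_finsetSum _ fun l _ => hm fun z => drawProb F z l * g (z + Pi.single l 1)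
  rw [hsum]
  have h1 : ∀ l, ∫⁻ ω, drawProb F (X n ω) l * g (X n ω + Pi.single l 1) ∂μ =
      ∫⁻ ω in {ω | X (n + 1) ω = X n ω + Pi.single l 1}, g (X (n + 1) ω) ∂μ := fun l => by
    refine (hX.setLIntegral_step n l fun z => g (z + Pi.single l 1)).symm.trans ?_
    exact setLIntegral_congr_fun (hs l) fun ω hω => by
      have hω : X (n + 1) ω = X n ω + Pi.single l 1 := hω
      simp only [hω]
  simp_rw [h1]
  have hd : Pairwise (Function.onFun Disjoint
      fun l => {ω | X (n + 1) ω = X n ω + Pi.single l 1}) := by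
    intro l l' hl
    refine Set.disjoint_left.2 fun ω (h : X (n + 1) ω = _) (h' : X (n + 1) ω = _) => hl ?_
    have h3 := add_left_cancel (h.symm.trans h')
    by_contra hne
    have := congrFun h3 l
    simp [Pi.single_eq_of_ne hne] at this
  rw [← tsum_fintype (L := .unconditional _), ← lintegral_iUnion hs hd,
    Measure.restrict_eq_self_of_ae_mem]
  filter_upwards [hX.ae_step hF hx₀] with ω hω
  exact Set.mem_iUnion.2 (hω n)

/-- The probability that the urn started from `x` has at least `c` balls of colour `i` after `k`
draws, in terms of the birth processes. -/
noncomputable def reachProb (F : Fin A → ℕ → ℝ) (i : Fin A) (c k : ℕ) (x : Fin A → ℕ) : ℝ≥0∞ :=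
  sojournLaw (rateAt F x) (reachEvent k i (c - x i))

lemma reachProb_of_le {i : Fin A} {c : ℕ} (k : ℕ) {x : Fin A → ℕ} (h : c ≤ x i) :
    reachProb F i c k x = 1 := by
  rw [reachProb, Nat.sub_eq_zero_of_le h, sojournLaw_reachEvent_zero]

lemma reachProb_zero_of_lt {i : Fin A} {c : ℕ} {x : Fin A → ℕ} (h : x i < c) :
    reachProb F i c 0 x = 0 := by
  obtain ⟨m, rfl⟩ : ∃ m, c = x i + (m + 1) := ⟨c - x i - 1, by omega⟩
  rw [reachProb, Nat.add_sub_cancel_left, reachEvent_zero_succ, measure_empty]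

lemma reachProb_succ (hF : ∀ j k, 1 ≤ k → 0 < F j k) (i : Fin A) (c k : ℕ) {x : Fin A → ℕ}
    (hx : ∀ j, 1 ≤ x j) :
    reachProb F i c (k + 1) x = ∑ l, drawProb F x l * reachProb F i c k (x + Pi.single l 1) := by
  have : Nonempty (Fin A) := ⟨i⟩
  rcases le_or_gt c (x i) with h | h
  · rw [reachProb_of_le _ h, ← sum_drawProb hF hx]
    refine Finset.sum_congr rfl fun l _ => ?_
    rw [reachProb_of_le _ (h.trans (by simp)), mul_one]
  · obtain ⟨m, rfl⟩ : ∃ m, c = x i + (m + 1) := ⟨c - x i - 1, by omega⟩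
    rw [reachProb, Nat.add_sub_cancel_left, sojournLaw_reachEvent_succ]
    refine Finset.sum_congr rfl fun l _ => ?_
    simp only [shiftRates_rateAt, rateAt_eq hF hx, add_zero]
    rw [drawProb, reachProb]
    congr 3
    split_ifs with h
    · subst h; simp; omega
    · simp [Pi.single_eq_of_ne (Ne.symm h)]

/-- `reachProb` satisfies the backward equation of the urn, so averaging it along the chain trades a
remaining draw for an elapsed one. At `k = 0` it is an indicator. The time `n` must stay free in the
induction. -/
lemma IsUrn.lintegral_reachProb (hX : IsUrn F x₀ X μ) (hF : ∀ j k, 1 ≤ k → 0 < F j k)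
    (hx₀ : ∀ j, 1 ≤ x₀ j) (i : Fin A) (c k : ℕ) :
    ∀ n, ∫⁻ ω, reachProb F i c k (X n ω) ∂μ = μ {ω | c ≤ X (n + k) ω i} := by
  have : Nonempty (Fin A) := ⟨i⟩
  induction k with
  | zero =>
    intro n
    have hm : MeasurableSet {ω | c ≤ X n ω i} :=
      measurableSet_le measurable_const ((measurable_pi_apply i).comp (hX.measurable n))
    rw [add_zero, ← lintegral_indicator_one hm]
    refine lintegral_congr fun ω => ?_
    by_cases h : c ≤ X n ω i
    · rw [reachProb_of_le _ h, Set.indicator_of_mem (by exact h)]; rfl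
    · rw [reachProb_zero_of_lt (not_le.1 h), Set.indicator_of_notMem (by exact h)]
  | succ k ih =>
    intro n
    rw [← add_assoc, add_right_comm, ← ih (n + 1), ← hX.lintegral_step hF hx₀]
    refine lintegral_congr_ae ?_
    filter_upwards [hX.ae_pos hF hx₀ n] with ω hω
    exact reachProb_succ hF i c k hω

lemma IsUrn.measure_le_count (hX : IsUrn F x₀ X μ) (hF : ∀ j k, 1 ≤ k → 0 < F j k)
    (hx₀ : ∀ j, 1 ≤ x₀ j) (i : Fin A) (m n : ℕ) :
    μ {ω | x₀ i + m ≤ X n ω i} = sojournLaw (rateAt F x₀) (reachEvent n i m) := by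
  have h := hX.lintegral_reachProb hF hx₀ i (x₀ i + m) n 0
  rw [zero_add] at h
  rw [← h]
  have : ∀ᵐ ω ∂μ, reachProb F i (x₀ i + m) n (X 0 ω) =
      sojournLaw (rateAt F x₀) (reachEvent n i m) := by
    filter_upwards [hX.init] with ω hω
    rw [hω, reachProb, Nat.add_sub_cancel_left]
  rw [lintegral_congr_ae this, lintegral_const, measure_univ, mul_one]

/-- The law of the final count, in terms of the explosion times. -/
lemma IsUrn.measure_le_finalCount (hX : IsUrn F x₀ X μ) (hF : ∀ j k, 1 ≤ k → 0 < F j k)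
    (hx₀ : ∀ j, 1 ≤ x₀ j) (i : Fin A) (m : ℕ) :
    μ {ω | ((x₀ i + m : ℕ) : ℕ∞) ≤ finalCount X i ω} =
      sojournLaw (rateAt F x₀) {σ | ENNReal.ofReal (hitTime i m σ) < minTotal i σ} := by
  have : Nonempty (Fin A) := ⟨i⟩
  have hU : {ω | ((x₀ i + m : ℕ) : ℕ∞) ≤ finalCount X i ω} = ⋃ n, {ω | x₀ i + m ≤ X n ω i} := by
    ext ω
    rw [Set.mem_ofPred_eq, coe_le_finalCount, Set.mem_iUnion]
    rfl
  -- The counts are monotone only almost surely, so continuity from below is applied to the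
  -- accumulated sets, which agree almost surely with the sets at time `n`.
  have h1 := tendsto_measure_iUnion_accumulate (μ := μ) (f := fun n => {ω | x₀ i + m ≤ X n ω i})
  rw [hU]
  refine tendsto_nhds_unique h1 ?_
  refine (tendsto_sojournLaw_reachEvent (rateAt F x₀) i m).congr fun n => ?_
  rw [← hX.measure_le_count hF hx₀]
  refine measure_congr ?_
  filter_upwards [hX.ae_monotone hF hx₀] with ω hω
  refine propext ⟨fun h => Set.mem_accumulate.2 ⟨n, le_rfl, h⟩, fun h => ?_⟩
  obtain ⟨k, hk, h⟩ := Set.mem_accumulate.1 h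
  exact le_trans h (hω hk i)

end Urn

/-! ### Independence of two blocks of coordinates. -/

section Merge

variable {ι : Type*} {X : ι → Type*} [∀ i, MeasurableSpace (X i)]

open Classical in
/-- The coordinates in `s` and those outside `s` are independent under a product measure. -/
lemma map_piecewise_infinitePi (ν : ∀ i, Measure (X i)) [∀ i, IsProbabilityMeasure (ν i)]
    (s : Set ι) :
    ((Measure.infinitePi ν).prod (Measure.infinitePi ν)).map
      (fun z => s.piecewise z.1 z.2) = Measure.infinitePi ν := by
  have hmeas : Measurable fun z : (∀ i, X i) × (∀ i, X i) => s.piecewise z.1 z.2 := by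
    refine measurable_pi_iff.2 fun i => ?_
    by_cases h : i ∈ s
    · simp only [Set.piecewise_eq_of_mem _ _ _ h]
      exact (measurable_pi_apply i).comp measurable_fst
    · simp only [Set.piecewise_eq_of_notMem _ _ _ h]
      exact (measurable_pi_apply i).comp measurable_snd
  refine Measure.eq_infinitePi _ fun u t ht => ?_
  rw [Measure.map_apply hmeas (MeasurableSet.pi u.countable_toSet fun i _ => ht i)]
  have hpre : (fun z : (∀ i, X i) × (∀ i, X i) => s.piecewise z.1 z.2) ⁻¹' (Set.pi u t) =
      (Set.pi (u.filter (· ∈ s) : Finset ι) t) ×ˢ (Set.pi (u.filter (· ∉ s) : Finset ι) t) := by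
    ext z
    simp only [Set.mem_preimage, Set.mem_pi, Set.mem_prod, Finset.mem_coe, Finset.mem_filter]
    constructor
    · refine fun h => ⟨fun i hi => ?_, fun i hi => ?_⟩
      · simpa [hi.2] using h i hi.1
      · simpa [hi.2] using h i hi.1
    · rintro ⟨h1, h2⟩ i hi
      by_cases h : i ∈ s
      · simpa [h] using h1 i ⟨hi, h⟩
      · simpa [h] using h2 i ⟨hi, h⟩
  rw [hpre, Measure.prod_prod, Measure.infinitePi_pi _ fun i _ => ht i,
    Measure.infinitePi_pi _ fun i _ => ht i, Finset.prod_filter_mul_prod_filter_not]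

end Merge

/-! ### Explosion times and the mass function of the final count. -/

section Explosion

variable {A : ℕ} (r : Fin A × ℕ → ℝ) [hr : Fact (∀ p, 0 < r p)]

/-- The time from the first draw of colour `j` to its explosion. -/
noncomputable def tailTime (j : Fin A) (σ : Fin A × ℕ → ℝ) : ℝ≥0∞ :=
  ∑' k, ENNReal.ofReal (σ (j, k + 1))

/-- The time from the first draw of colour `j` to its draw number `m + 1`. -/
def partialTail (j : Fin A) (m : ℕ) (σ : Fin A × ℕ → ℝ) : ℝ := ∑ k ∈ Finset.range m, σ (j, k + 1)

@[fun_prop]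
lemma measurable_tailTime (j : Fin A) : Measurable (tailTime j) := by
  unfold tailTime; fun_prop

@[fun_prop]
lemma measurable_partialTail (j : Fin A) (m : ℕ) : Measurable (partialTail j m) := by
  unfold partialTail; fun_prop

lemma totalTime_eq_add (j : Fin A) (σ : Fin A × ℕ → ℝ) :
    totalTime j σ = ENNReal.ofReal (σ (j, 0)) + tailTime j σ :=
  tsum_eq_zero_add' ENNReal.summable

lemma totalTime_update_of_ne {j l : Fin A} (h : j ≠ l) (k : ℕ) (σ : Fin A × ℕ → ℝ) (s : ℝ) :
    totalTime j (Function.update σ (l, k) s) = totalTime j σ := by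
  simp [totalTime, h]

lemma minTotal_update (i : Fin A) (k : ℕ) (σ : Fin A × ℕ → ℝ) (s : ℝ) :
    minTotal i (Function.update σ (i, k) s) = minTotal i σ :=
  iInf_congr fun j => totalTime_update_of_ne j.2 _ _ _

lemma tailTime_update_zero (j l : Fin A) (σ : Fin A × ℕ → ℝ) (s : ℝ) :
    tailTime j (Function.update σ (l, 0) s) = tailTime j σ := by
  simp [tailTime]

lemma partialTail_update_zero (j l : Fin A) (m : ℕ) (σ : Fin A × ℕ → ℝ) (s : ℝ) :
    partialTail j m (Function.update σ (l, 0) s) = partialTail j m σ := by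
  simp [partialTail]

lemma partialTail_update_last (j : Fin A) (m : ℕ) (σ : Fin A × ℕ → ℝ) (s : ℝ) :
    partialTail j m (Function.update σ (j, m + 1) s) = partialTail j m σ :=
  Finset.sum_congr rfl fun k hk => by
    have : k ≠ m := (Finset.mem_range.1 hk).ne
    simp [this]

/-- The expected explosion time is at most a constant times the sum of the inverse rates. -/
lemma ae_totalTime_lt_top {j : Fin A} (hj : Summable fun k => 1 / r (j, k)) :
    ∀ᵐ σ ∂sojournLaw r, totalTime j σ < ∞ := by
  refine ae_lt_top (measurable_totalTime j) (ne_of_lt ?_)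
  unfold totalTime
  have hsum : ∫⁻ σ, ∑' k, ENNReal.ofReal (σ (j, k)) ∂sojournLaw r =
      ∑' k, ∫⁻ σ, ENNReal.ofReal (σ (j, k)) ∂sojournLaw r :=
    lintegral_tsum fun k =>
      (ENNReal.measurable_ofReal.comp (measurable_pi_apply (j, k))).aemeasurable
  rw [hsum]
  have h : ∀ k, ∫⁻ σ, ENNReal.ofReal (σ (j, k)) ∂sojournLaw r ≤
      ENNReal.ofReal (4 * (1 / r (j, k))) := fun k =>
    ((measurePreserving_eval_infinitePi (fun p => expMeasure (r p)) (j, k)).lintegral_comp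
      ENNReal.measurable_ofReal).trans_le (lintegral_ofReal_expMeasure_le (hr.out _))
  refine (ENNReal.tsum_le_tsum h).trans_lt ?_
  rw [← ENNReal.ofReal_tsum_of_nonneg (fun k => by have := hr.out (j, k); positivity)
    (hj.mul_left 4)]
  exact ENNReal.ofReal_lt_top

lemma ae_tailTime_lt_top {j : Fin A} (hj : Summable fun k => 1 / r (j, k)) :
    ∀ᵐ σ ∂sojournLaw r, tailTime j σ < ∞ := by
  filter_upwards [ae_totalTime_lt_top r hj] with σ hσ
  rw [totalTime_eq_add] at hσ
  exact lt_of_le_of_lt le_add_self hσ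

lemma ae_minTotal_lt_top {i : Fin A} (h : ∃ j, j ≠ i ∧ Summable fun k => 1 / r (j, k)) :
    ∀ᵐ σ ∂sojournLaw r, minTotal i σ < ∞ := by
  obtain ⟨j, hji, hj⟩ := h
  filter_upwards [ae_totalTime_lt_top r hj] with σ hσ
  exact (iInf_le (fun j : {j : Fin A // j ≠ i} => totalTime j.1 σ) ⟨j, hji⟩).trans_lt hσ

/-- Two explosion times almost surely do not coincide, unless they are infinite. -/
lemma ae_totalTime_ne {j l : Fin A} (h : j ≠ l) :
    ∀ᵐ σ ∂sojournLaw r, totalTime j σ = totalTime l σ → totalTime j σ = ∞ := by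
  have hZ : Measurable fun σ : Fin A × ℕ → ℝ => (totalTime l σ).toReal - (tailTime j σ).toReal := by
    fun_prop
  filter_upwards [ae_pos_sojournLaw r, ae_ne_of_update_eq r (j, 0) hZ fun σ s => by
    rw [totalTime_update_of_ne h.symm, tailTime_update_zero]] with σ hpos hσ heq
  by_contra htop
  rw [totalTime_eq_add] at htop heq
  have hR : tailTime j σ ≠ ∞ := fun h => htop (by simp [h])
  refine hσ ?_
  rw [← heq, ENNReal.toReal_add ENNReal.ofReal_ne_top hR, ENNReal.toReal_ofReal (hpos _).le]
  ring

lemma hitTime_succ_eq_add (j : Fin A) (m : ℕ) (σ : Fin A × ℕ → ℝ) :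
    hitTime j (m + 1) σ = partialTail j m σ + σ (j, 0) := hitTime_succ' j m σ

lemma ae_hitTime_ne (i : Fin A) (m : ℕ) :
    ∀ᵐ σ ∂sojournLaw r, hitTime i (m + 1) σ ≠ (minTotal i σ).toReal := by
  have hZ : Measurable fun σ : Fin A × ℕ → ℝ => (minTotal i σ).toReal - partialTail i m σ := by
    fun_prop
  filter_upwards [ae_ne_of_update_eq r (i, 0) hZ fun σ s => by
    rw [minTotal_update, partialTail_update_zero]] with σ hσ heq
  rw [hitTime_succ_eq_add] at heq
  exact hσ (by linarith)

/-- `tailTime i` almost surely differs from any variable that does not depend on the second sojourn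
time of colour `i`. -/
lemma ae_tailTime_ne {i : Fin A} (hi : Summable fun k => 1 / r (i, k))
    {Z : (Fin A × ℕ → ℝ) → ℝ} (hZ : Measurable Z)
    (hp : ∀ σ s, Z (Function.update σ (i, 1) s) = Z σ) :
    ∀ᵐ σ ∂sojournLaw r, (tailTime i σ).toReal ≠ Z σ := by
  have hZ' : Measurable fun σ : Fin A × ℕ → ℝ =>
      Z σ - (∑' k, ENNReal.ofReal (σ (i, k + 2))).toReal := by fun_prop
  filter_upwards [ae_tailTime_lt_top r hi, ae_pos_sojournLaw r,
    ae_ne_of_update_eq r (i, 1) hZ' fun σ s => by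
      rw [hp]; simp] with σ htop hpos hσ heq
  have h : tailTime i σ = ENNReal.ofReal (σ (i, 1)) + ∑' k, ENNReal.ofReal (σ (i, k + 2)) :=
    tsum_eq_zero_add' ENNReal.summable
  have hne : ∑' k, ENNReal.ofReal (σ (i, k + 2)) ≠ ∞ := fun h' => by simp [h, h'] at htop
  rw [h, ENNReal.toReal_add ENNReal.ofReal_ne_top hne, ENNReal.toReal_ofReal (hpos _).le] at heq
  exact hσ (by linarith)

/-- The probability that the minimal explosion time falls between two consecutive draws. -/
lemma sojournLaw_lt_minTotal_eq_add {i : Fin A}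
    (hother : ∃ j, j ≠ i ∧ Summable fun k => 1 / r (j, k)) (m : ℕ) :
    sojournLaw r {σ | ENNReal.ofReal (hitTime i (m + 1) σ) < minTotal i σ} =
      sojournLaw r {σ | ENNReal.ofReal (hitTime i (m + 2) σ) < minTotal i σ} +
      ENNReal.ofReal (1 / r (i, m + 1)) *
        ∫⁻ σ, exponentialPDF (r (i, 0)) ((minTotal i σ).toReal - partialTail i (m + 1) σ)
          ∂sojournLaw r := by
  let S : Set (Fin A × ℕ → ℝ) := {σ | 0 ≤ (minTotal i σ).toReal - hitTime i (m + 1) σ ∧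
    (minTotal i σ).toReal - hitTime i (m + 1) σ < σ (i, m + 1)}
  have hS : MeasurableSet S := by
    have h : Measurable fun σ => (minTotal i σ).toReal - hitTime i (m + 1) σ := by fun_prop
    exact (measurableSet_le measurable_const h).inter (measurableSet_lt h (measurable_pi_apply _))
  have hm2 : MeasurableSet {σ : Fin A × ℕ → ℝ |
      ENNReal.ofReal (hitTime i (m + 2) σ) < minTotal i σ} :=
    measurableSet_lt (by fun_prop) (by fun_prop)
  -- `toReal` would send an infinite minimum to `0`; the explosive colour in `hother` excludes this
  -- almost surely.
  have hlt : ∀ {σ : Fin A × ℕ → ℝ}, (∀ p, 0 < σ p) → minTotal i σ < ∞ → ∀ n,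
      (ENNReal.ofReal (hitTime i n σ) < minTotal i σ ↔ hitTime i n σ < (minTotal i σ).toReal) :=
    fun hpos htop n => by
      rw [ENNReal.ofReal_lt_iff_lt_toReal (hitTime_nonneg i n hpos) htop.ne]
  have hsucc : ∀ σ, hitTime i (m + 2) σ = hitTime i (m + 1) σ + σ (i, m + 1) := fun σ =>
    Finset.sum_range_succ _ _
  have hunion : sojournLaw r {σ | ENNReal.ofReal (hitTime i (m + 1) σ) < minTotal i σ} =
      sojournLaw r ({σ | ENNReal.ofReal (hitTime i (m + 2) σ) < minTotal i σ} ∪ S) := by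
    refine measure_congr ?_
    filter_upwards [ae_pos_sojournLaw r, ae_minTotal_lt_top r hother, ae_hitTime_ne r i m,
      ae_hitTime_ne r i (m + 1)] with σ hpos htop h1 h2
    have hp := hpos (i, m + 1)
    have hs := hsucc σ
    refine propext ((hlt hpos htop _).trans (Iff.trans ?_ (or_congr (hlt hpos htop _).symm Iff.rfl)))
    change _ ↔ _ ∨ (0 ≤ _ - _ ∧ _ - _ < _)
    constructor
    · intro h
      rcases lt_or_gt_of_ne h2 with h3 | h3
      · exact Or.inl h3
      · exact Or.inr ⟨by linarith, by linarith⟩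
    · rintro (h | ⟨h, -⟩)
      · linarith
      · exact lt_of_le_of_ne (by linarith) h1
  have hdisj : AEDisjoint (sojournLaw r)
      {σ | ENNReal.ofReal (hitTime i (m + 2) σ) < minTotal i σ} S := by
    have h : ∀ᵐ σ ∂sojournLaw r,
        ¬ σ ∈ {σ | ENNReal.ofReal (hitTime i (m + 2) σ) < minTotal i σ} ∩ S := by
      filter_upwards [ae_pos_sojournLaw r, ae_minTotal_lt_top r hother] with σ hpos htop h
      have h1 := (hlt hpos htop _).1 h.1
      have h2 := h.2.2
      rw [hsucc] at h1
      linarith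
    exact measure_eq_zero_iff_ae_notMem.2 h
  have hZ : ∀ {f : (Fin A × ℕ → ℝ) → ℝ} {a : ℝ}, Measurable f →
      Measurable fun σ => exponentialPDF a (f σ) := fun hf => (measurable_exponentialPDF _).comp hf
  rw [hunion, measure_union₀ hS.nullMeasurableSet hdisj]
  congr 1
  calc sojournLaw r S
      = ∫⁻ σ, ENNReal.ofReal (1 / r (i, m + 1)) *
          exponentialPDF (r (i, m + 1)) ((minTotal i σ).toReal - hitTime i (m + 1) σ)
          ∂sojournLaw r := by
        -- Neither the minimum nor `hitTime i (m + 1)` involves the sojourn `(i, m + 1)`, so it can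
        -- be integrated out; its tail is its density divided by its rate.
        rw [sojournLaw_eq_lintegral_update r (i, m + 1) hS]
        refine lintegral_congr fun σ => ?_
        rw [← expMeasure_setOf_nonneg_and_lt (hr.out _)]
        congr 1
        ext s
        change _ ∧ _ ↔ _ ∧ _
        rw [minTotal_update, Function.update_self, hitTime_succ_eq_add, hitTime_succ_eq_add,
          partialTail_update_last, Function.update_of_ne (by simp)]
    _ = ENNReal.ofReal (1 / r (i, m + 1)) *
          ∫⁻ σ, exponentialPDF (r (i, m + 1)) ((minTotal i σ).toReal - hitTime i (m + 1) σ)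
          ∂sojournLaw r := lintegral_const_mul _ (hZ (by fun_prop))
    _ = _ := by
        congr 1
        -- The left side integrates the density of clock `(i, m + 1)` over clock `(i, 0)`, the right
        -- side the reverse; commutativity of convolution makes them equal. Afterwards the rate in
        -- the density no longer depends on `m`.
        rw [lintegral_sojournLaw_update r (i, 0) (hZ (by fun_prop)),
          lintegral_sojournLaw_update r (i, m + 1) (hZ (by fun_prop))]
        refine lintegral_congr fun σ => ?_
        have h := lintegral_exponentialPDF_sub_comm (r (i, 0)) (r (i, m + 1))
          ((minTotal i σ).toReal - partialTail i m σ)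
        refine Eq.trans (lintegral_congr fun s => ?_) (h.trans (lintegral_congr fun s => ?_))
        · rw [minTotal_update, hitTime_succ_eq_add, partialTail_update_zero, Function.update_self,
            sub_sub]
        · have hlast : partialTail i (m + 1) (Function.update σ (i, m + 1) s) =
              partialTail i m σ + s := by
            rw [partialTail, Finset.sum_range_succ, Function.update_self]
            congr 1
            exact partialTail_update_last i m σ s
          rw [minTotal_update, hlast, sub_sub]

/-- The mean density at the minimal explosion time of the other colours. -/
noncomputable def meanPDF (i : Fin A) : ℝ≥0∞ :=
  ∫⁻ σ, exponentialPDF (r (i, 0)) ((minTotal i σ).toReal - (tailTime i σ).toReal) ∂sojournLaw r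

lemma tendsto_partialTail {i : Fin A} {σ : Fin A × ℕ → ℝ} (hpos : ∀ p, 0 < σ p)
    (h : tailTime i σ < ∞) :
    Tendsto (fun m => partialTail i m σ) atTop (𝓝 (tailTime i σ).toReal) := by
  have h1 : Tendsto (fun m => ∑ k ∈ Finset.range m, ENNReal.ofReal (σ (i, k + 1))) atTop
      (𝓝 (tailTime i σ)) := ENNReal.summable.hasSum.tendsto_sum_nat
  refine ((ENNReal.tendsto_toReal h.ne).comp h1).congr fun m => ?_
  rw [Function.comp_apply, ← ENNReal.ofReal_sum_of_nonneg fun _ _ => (hpos _).le,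
    ENNReal.toReal_ofReal (Finset.sum_nonneg fun _ _ => (hpos _).le)]
  rfl

/-- Dominated convergence with the constant `r (i, 0)`. The density jumps only at `0`, and
`tailTime` almost surely differs from the minimum. -/
lemma tendsto_lintegral_exponentialPDF {i : Fin A} (hi : Summable fun k => 1 / r (i, k)) :
    Tendsto (fun m => ∫⁻ σ, exponentialPDF (r (i, 0))
      ((minTotal i σ).toReal - partialTail i m σ) ∂sojournLaw r) atTop (𝓝 (meanPDF r i)) := by
  refine tendsto_lintegral_of_dominated_convergence (fun _ => ENNReal.ofReal (r (i, 0)))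
    (fun m => (measurable_exponentialPDF _).comp (by fun_prop))
    (fun m => Eventually.of_forall fun σ => exponentialPDF_le (hr.out _) _) ?_ ?_
  · simp
  · filter_upwards [ae_pos_sojournLaw r, ae_tailTime_lt_top r hi,
      ae_tailTime_ne r hi (Z := fun σ => (minTotal i σ).toReal) (by fun_prop)
        fun σ s => by rw [minTotal_update]] with σ hpos htop hne
    exact (continuousAt_exponentialPDF _ (sub_ne_zero.2 hne.symm)).tendsto.comp
      ((tendsto_partialTail hpos htop).const_sub _)

lemma meanPDF_ne_top (i : Fin A) : meanPDF r i ≠ ∞ := by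
  refine ne_of_lt ((lintegral_mono fun σ => exponentialPDF_le (hr.out (i, 0)) _).trans_lt ?_)
  simp

lemma sojournLaw_inter_lt_apply (p : Fin A × ℕ) {S : Set (Fin A × ℕ → ℝ)} (hS : MeasurableSet S)
    (hp : ∀ σ s, Function.update σ p s ∈ S ↔ σ ∈ S) {c : ℝ} (hc : 0 ≤ c) :
    sojournLaw r (S ∩ {σ | c < σ p}) =
      ENNReal.ofReal (Real.exp (-(r p * c))) * sojournLaw r S := by
  rw [sojournLaw_eq_lintegral_update r p
    (hS.inter (measurableSet_lt measurable_const (measurable_pi_apply p))),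
    ← lintegral_indicator_one hS, ← lintegral_const_mul _ (measurable_one.indicator hS)]
  refine lintegral_congr fun σ => ?_
  by_cases h : σ ∈ S
  · have : {s | Function.update σ p s ∈ S ∩ {σ | c < σ p}} = Set.Ioi c := by
      ext s; simp [hp, h]
    rw [this, expMeasure_Ioi (hr.out _) hc, Set.indicator_of_mem h]
    simp
  · have : {s | Function.update σ p s ∈ S ∩ {σ | c < σ p}} = ∅ := by
      ext s; simp [hp, h]
    rw [this, measure_empty, Set.indicator_of_notMem h, mul_zero]

lemma exists_sojournLaw_le_pos {T : (Fin A × ℕ → ℝ) → ℝ≥0∞} (hT : Measurable T)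
    (htop : ∀ᵐ σ ∂sojournLaw r, T σ < ∞) :
    ∃ c : ℝ, 0 ≤ c ∧ 0 < sojournLaw r {σ | T σ ≤ ENNReal.ofReal c} := by
  have hU : sojournLaw r (⋃ n : ℕ, {σ | T σ ≤ ENNReal.ofReal n}) = 1 := by
    rw [← mem_ae_iff_prob_eq_one
      (MeasurableSet.iUnion fun n => measurableSet_le hT measurable_const)]
    filter_upwards [htop] with σ hσ
    obtain ⟨n, hn⟩ := ENNReal.exists_nat_gt hσ.ne
    exact Set.mem_iUnion.2 ⟨n, by simpa using hn.le⟩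
  by_contra! h
  have : sojournLaw r (⋃ n : ℕ, {σ | T σ ≤ ENNReal.ofReal n}) = 0 :=
    measure_iUnion_null fun n => le_antisymm (h n n.cast_nonneg) zero_le
  rw [hU] at this
  exact one_ne_zero this

/-- With positive probability `tailTime i` is at most some `c` while the first sojourns of all other
colours exceed `c`. The minimum is then larger than `tailTime i`, where the exponential density is
positive. -/
lemma meanPDF_ne_zero {i : Fin A} (hi : Summable fun k => 1 / r (i, k))
    (hother : ∃ j, j ≠ i ∧ Summable fun k => 1 / r (j, k)) : meanPDF r i ≠ 0 := by
  obtain ⟨c, hc, hpos⟩ := exists_sojournLaw_le_pos r (measurable_tailTime i)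
    (ae_tailTime_lt_top r hi)
  -- First sojourns do not enter `tailTime`, so each further condition `c < σ (a, 0)` is independent
  -- of the preceding ones and contributes a positive factor.
  have hstep : ∀ s : Finset (Fin A), 0 < sojournLaw r ({σ | tailTime i σ ≤ ENNReal.ofReal c} ∩
      {σ | ∀ j ∈ s, c < σ (j, 0)}) := by
    intro s
    induction s using Finset.induction_on with
    | empty => simpa using hpos
    | insert a s ha ih =>
      have hset : ({σ | tailTime i σ ≤ ENNReal.ofReal c} ∩
          {σ | ∀ j ∈ insert a s, c < σ (j, 0)} : Set (Fin A × ℕ → ℝ)) =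
          ({σ | tailTime i σ ≤ ENNReal.ofReal c} ∩ {σ | ∀ j ∈ s, c < σ (j, 0)}) ∩
            {σ | c < σ (a, 0)} := by
        ext σ
        simp only [Set.mem_inter_iff, Set.mem_ofPred_eq, Finset.mem_insert, forall_eq_or_imp]
        tauto
      have hm : MeasurableSet ({σ | tailTime i σ ≤ ENNReal.ofReal c} ∩
          {σ | ∀ j ∈ s, c < σ (j, 0)} : Set (Fin A × ℕ → ℝ)) := by
        refine (measurableSet_le (by fun_prop) measurable_const).inter ?_
        simp only [Set.ofPred_forall]
        exact MeasurableSet.iInter fun j => MeasurableSet.iInter fun _ =>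
          measurableSet_lt measurable_const (measurable_pi_apply _)
      rw [hset, sojournLaw_inter_lt_apply r (a, 0) hm _ hc]
      · exact ENNReal.mul_pos (ENNReal.ofReal_pos.2 (Real.exp_pos _)).ne' ih.ne'
      · intro σ s'
        simp only [Set.mem_inter_iff, Set.mem_ofPred_eq, tailTime_update_zero]
        refine and_congr_right fun _ => forall₂_congr fun j hj => ?_
        have : j ≠ a := fun h => ha (h ▸ hj)
        simp [this]
  have hs := hstep (Finset.univ.erase i)
  rw [meanPDF, ← pos_iff_ne_zero, lintegral_pos_iff_support]
  · refine hs.trans_le (measure_mono_ae ?_)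
    filter_upwards [ae_pos_sojournLaw r, ae_minTotal_lt_top r hother] with σ hσ htop h
    obtain ⟨h1, h2⟩ : tailTime i σ ≤ ENNReal.ofReal c ∧
      ∀ j ∈ Finset.univ.erase i, c < σ (j, 0) := h
    have h3 : ENNReal.ofReal c < minTotal i σ := by
      refine (lt_minTotal_iff ENNReal.ofReal_ne_top).2 fun j hj => ?_
      refine lt_of_lt_of_le ?_ (ENNReal.le_tsum 0)
      exact (ENNReal.ofReal_lt_ofReal_iff (hσ _)).2
        (h2 j (Finset.mem_erase.2 ⟨hj, Finset.mem_univ _⟩))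
    have h4 : (tailTime i σ).toReal < (minTotal i σ).toReal :=
      (ENNReal.toReal_lt_toReal (h1.trans_lt ENNReal.ofReal_lt_top).ne htop.ne).2 (h1.trans_lt h3)
    refine Function.mem_support.2 (ENNReal.ofReal_pos.2 ?_).ne'
    exact exponentialPDFReal_pos (hr.out _) (sub_pos.2 h4)
  · exact (measurable_exponentialPDF _).comp (by fun_prop)

/-- It suffices that the minimum is at most `c` while the first sojourn of `i`, which is independent
of it, exceeds `c`. -/
lemma sojournLaw_minTotal_lt_totalTime_pos {i : Fin A}
    (hother : ∃ j, j ≠ i ∧ Summable fun k => 1 / r (j, k)) :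
    0 < sojournLaw r {σ | minTotal i σ < totalTime i σ} := by
  obtain ⟨c, hc, hpos⟩ := exists_sojournLaw_le_pos r (measurable_minTotal i)
    (ae_minTotal_lt_top r hother)
  have h : 0 < sojournLaw r ({σ | minTotal i σ ≤ ENNReal.ofReal c} ∩ {σ | c < σ (i, 0)}) := by
    rw [sojournLaw_inter_lt_apply r (i, 0) (measurableSet_le (by fun_prop) measurable_const) _ hc]
    · exact ENNReal.mul_pos (ENNReal.ofReal_pos.2 (Real.exp_pos _)).ne' hpos.ne'
    · intro σ s
      simp only [Set.mem_ofPred_eq, minTotal_update]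
  refine h.trans_le (measure_mono fun σ hσ => ?_)
  have h2 : c < σ (i, 0) := hσ.2
  refine lt_of_le_of_lt hσ.1 (lt_of_lt_of_le ?_ (ENNReal.le_tsum 0))
  exact (ENNReal.ofReal_lt_ofReal_iff (hc.trans_lt h2)).2 h2

end Explosion

/-! ### Regularity of the exponential distribution function. -/

section ExponentialCDF

lemma expMeasure_real_Iic {r : ℝ} (hr : 0 < r) (u : ℝ) :
    (expMeasure r).real (Set.Iic u) = if 0 ≤ u then 1 - Real.exp (-(r * u)) else 0 := by
  have := isProbabilityMeasure_expMeasure hr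
  rw [← cdf_eq_real, cdf_expMeasure_eq hr]

lemma lipschitzWith_expMeasure_real_Iic {r : ℝ} (hr : 0 < r) :
    LipschitzWith (Real.nnabs r) fun u => (expMeasure r).real (Set.Iic u) := by
  have := isProbabilityMeasure_expMeasure hr
  have key : ∀ u v : ℝ, u ≤ v → (expMeasure r).real (Set.Iic v) - (expMeasure r).real (Set.Iic u) ≤
      r * (v - u) := by
    intro u v huv
    rw [← measureReal_sdiff (Set.Iic_subset_Iic.2 huv) measurableSet_Iic, measureReal_def]
    refine ENNReal.toReal_le_of_le_ofReal (mul_nonneg hr.le (sub_nonneg.2 huv)) ?_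
    have hset : Set.Iic v \ Set.Iic u = Set.Ioc u v := by ext; simp [and_comm]
    rw [hset, ENNReal.ofReal_mul hr.le, ← Real.volume_Ioc]
    calc expMeasure r (Set.Ioc u v) = ∫⁻ s in Set.Ioc u v, exponentialPDF r s :=
          withDensity_apply _ measurableSet_Ioc
      _ ≤ ∫⁻ s in Set.Ioc u v, ENNReal.ofReal r := lintegral_mono fun s => exponentialPDF_le hr s
      _ = _ := by rw [setLIntegral_const]
  have hmono : Monotone fun u => (expMeasure r).real (Set.Iic u) := fun u v h =>
    measureReal_mono (Set.Iic_subset_Iic.2 h)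
  refine LipschitzWith.of_dist_le_mul fun u v => ?_
  rw [Real.dist_eq, Real.dist_eq, Real.coe_nnabs, abs_of_pos hr]
  rcases le_total u v with h | h
  · rw [abs_sub_comm, abs_sub_comm u, abs_of_nonneg (sub_nonneg.2 (hmono h)),
      abs_of_nonneg (sub_nonneg.2 h)]
    exact key u v h
  · rw [abs_of_nonneg (sub_nonneg.2 (hmono h)), abs_of_nonneg (sub_nonneg.2 h)]
    exact key v u h

lemma hasDerivAt_expMeasure_real_Iic {r : ℝ} (hr : 0 < r) {u : ℝ} (hu : u ≠ 0) :
    HasDerivAt (fun u => (expMeasure r).real (Set.Iic u)) (exponentialPDF r u).toReal u := by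
  rcases lt_or_gt_of_ne hu with h | h
  · rw [exponentialPDF_of_neg h]
    refine (hasDerivAt_const u (0 : ℝ)).congr_of_eventuallyEq ?_
    filter_upwards [eventually_lt_nhds h] with s hs
    rw [expMeasure_real_Iic hr, if_neg (not_le.2 hs)]
  · rw [exponentialPDF_of_nonneg h.le, ENNReal.toReal_ofReal (by positivity)]
    have h1 := (hasDerivAt_neg_exp_mul_exp (r := r) (x := u)).const_add 1
    refine h1.congr_of_eventuallyEq ?_
    filter_upwards [eventually_gt_nhds h] with s hs
    rw [expMeasure_real_Iic hr, if_pos hs.le, sub_eq_add_neg]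

end ExponentialCDF

/-! ### The density of the explosion time. -/

section Density

variable {A : ℕ} (r : Fin A × ℕ → ℝ) [hr : Fact (∀ p, 0 < r p)]

lemma sojournLaw_real_totalTime_le {i : Fin A} (hi : Summable fun k => 1 / r (i, k)) (t : ℝ) :
    (sojournLaw r).real {σ | (totalTime i σ : EReal) ≤ (t : EReal)} =
      ∫ σ, (expMeasure (r (i, 0))).real (Set.Iic (t - (tailTime i σ).toReal)) ∂sojournLaw r := by
  have h1 : sojournLaw r {σ | (totalTime i σ : EReal) ≤ (t : EReal)} =
      sojournLaw r {σ | σ (i, 0) + (tailTime i σ).toReal ≤ t} := by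
    refine measure_congr ?_
    filter_upwards [ae_pos_sojournLaw r, ae_tailTime_lt_top r hi] with σ hpos htop
    have h : totalTime i σ = ENNReal.ofReal (σ (i, 0) + (tailTime i σ).toReal) := by
      rw [totalTime_eq_add, ENNReal.ofReal_add (hpos _).le ENNReal.toReal_nonneg,
        ENNReal.ofReal_toReal htop.ne]
    have h0 : 0 ≤ σ (i, 0) + (tailTime i σ).toReal :=
      add_nonneg (hpos _).le ENNReal.toReal_nonneg
    refine propext ?_
    change (totalTime i σ : EReal) ≤ (t : EReal) ↔ _ ≤ t
    rw [h, EReal.coe_ennreal_ofReal, max_eq_left h0, EReal.coe_le_coe_iff]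
  have hm : MeasurableSet {σ : Fin A × ℕ → ℝ | σ (i, 0) + (tailTime i σ).toReal ≤ t} :=
    measurableSet_le (by fun_prop) measurable_const
  rw [measureReal_def, h1, sojournLaw_eq_lintegral_update r (i, 0) hm]
  simp_rw [measureReal_def]
  rw [integral_toReal]
  · congr 1
    refine lintegral_congr fun σ => ?_
    congr 1
    ext s
    change Function.update σ (i, 0) s (i, 0) +
      (tailTime i (Function.update σ (i, 0) s)).toReal ≤ t ↔ s ≤ t - (tailTime i σ).toReal
    rw [tailTime_update_zero, Function.update_self, le_sub_iff_add_le]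
  · have : Monotone fun u => expMeasure (r (i, 0)) (Set.Iic u) := fun u v h =>
      measure_mono (Set.Iic_subset_Iic.2 h)
    exact (this.measurable.comp (by fun_prop)).aemeasurable
  · exact Eventually.of_forall fun σ => measure_lt_top _ _

/-- The explosion time has a density. -/
lemma hasDerivAt_sojournLaw_real_totalTime_le {i : Fin A} (hi : Summable fun k => 1 / r (i, k))
    (t : ℝ) :
    HasDerivAt (fun t : ℝ => (sojournLaw r).real {σ | (totalTime i σ : EReal) ≤ (t : EReal)})
      (∫⁻ σ, exponentialPDF (r (i, 0)) (t - (tailTime i σ).toReal) ∂sojournLaw r).toReal t := by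
  simp_rw [sojournLaw_real_totalTime_le r hi]
  have hlip := lipschitzWith_expMeasure_real_Iic (hr.out (i, 0))
  have hmeas : ∀ t : ℝ, AEStronglyMeasurable (fun σ =>
      (expMeasure (r (i, 0))).real (Set.Iic (t - (tailTime i σ).toReal))) (sojournLaw r) := fun t =>
    (hlip.continuous.measurable.comp (by fun_prop)).aestronglyMeasurable
  have hpdf : Measurable fun σ => exponentialPDF (r (i, 0)) (t - (tailTime i σ).toReal) :=
    (measurable_exponentialPDF _).comp (by fun_prop)
  -- The exponential distribution function has a kink at `0`, so the integrand fails to be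
  -- differentiable when `tailTime i σ = t`. This is a null event, and the Lipschitz bound `r (i,
  -- 0)` serves as domination.
  have h := hasDerivAt_integral_of_dominated_loc_of_lip (μ := sojournLaw r)
    (F := fun t σ => (expMeasure (r (i, 0))).real (Set.Iic (t - (tailTime i σ).toReal)))
    (F' := fun σ => (exponentialPDF (r (i, 0)) (t - (tailTime i σ).toReal)).toReal)
    (x₀ := t) (s := Set.univ) (bound := fun _ => r (i, 0)) univ_mem
    (Eventually.of_forall hmeas) ?_ hpdf.ennreal_toReal.aestronglyMeasurable ?_
    (integrable_const _) ?_
  · rw [integral_toReal hpdf.aemeasurable] at h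
    · exact h.2
    · exact Eventually.of_forall fun σ => ENNReal.ofReal_lt_top
  · refine Integrable.of_bound (hmeas t) 1 (Eventually.of_forall fun σ => ?_)
    rw [Real.norm_of_nonneg measureReal_nonneg]
    exact measureReal_le_one
  · refine Eventually.of_forall fun σ => LipschitzWith.lipschitzOnWith ?_
    refine LipschitzWith.of_dist_le_mul fun u v => ?_
    simpa using hlip.dist_le_mul (u - (tailTime i σ).toReal) (v - (tailTime i σ).toReal)
  · filter_upwards [ae_tailTime_ne r hi (Z := fun _ => t) measurable_const fun _ _ => rfl]
      with σ hσ
    exact (hasDerivAt_expMeasure_real_Iic (hr.out _) (sub_ne_zero.2 hσ.symm)).comp_sub_const t _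

/-- The minimum uses only the clocks of colours other than `i`, and `tailTime i` only those of `i`;
the two blocks may be sampled independently. -/
lemma meanPDF_eq_lintegral_lintegral (i : Fin A) :
    meanPDF r i = ∫⁻ σ, ∫⁻ σ', exponentialPDF (r (i, 0))
      ((minTotal i σ).toReal - (tailTime i σ').toReal) ∂sojournLaw r ∂sojournLaw r := by
  classical
  have hm : Measurable fun z : (Fin A × ℕ → ℝ) × (Fin A × ℕ → ℝ) => exponentialPDF (r (i, 0))
      ((minTotal i z.1).toReal - (tailTime i z.2).toReal) :=
    (measurable_exponentialPDF _).comp (by fun_prop)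
  have hp : Measurable fun z : (Fin A × ℕ → ℝ) × (Fin A × ℕ → ℝ) =>
      {p : Fin A × ℕ | p.1 ≠ i}.piecewise z.1 z.2 := by
    refine measurable_pi_iff.2 fun p => ?_
    by_cases h : p.1 = i
    · simp only [Set.piecewise, Set.mem_ofPred_eq, h, ne_eq, not_true_eq_false, if_false]
      fun_prop
    · simp only [Set.piecewise, Set.mem_ofPred_eq, h, ne_eq, not_false_eq_true, if_true]
      fun_prop
  have hmap : ((sojournLaw r).prod (sojournLaw r)).map (fun z =>
      {p : Fin A × ℕ | p.1 ≠ i}.piecewise z.1 z.2) = sojournLaw r := by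
    have h := map_piecewise_infinitePi (fun p => expMeasure (r p)) {p : Fin A × ℕ | p.1 ≠ i}
    unfold sojournLaw
    convert h
  have hf : Measurable fun σ => exponentialPDF (r (i, 0))
      ((minTotal i σ).toReal - (tailTime i σ).toReal) :=
    (measurable_exponentialPDF _).comp (by fun_prop)
  rw [← lintegral_prod _ hm.aemeasurable, meanPDF]
  conv_lhs => rw [← hmap]
  rw [lintegral_map hf hp]
  refine lintegral_congr fun z => ?_
  have h1 : minTotal i ({p : Fin A × ℕ | p.1 ≠ i}.piecewise z.1 z.2) = minTotal i z.1 :=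
    iInf_congr fun j => tsum_congr fun k => by
      rw [Set.piecewise_eq_of_mem _ _ _ (by exact j.2)]
  have h2 : tailTime i ({p : Fin A × ℕ | p.1 ≠ i}.piecewise z.1 z.2) = tailTime i z.2 :=
    tsum_congr fun k => by
      rw [Set.piecewise_eq_of_notMem _ _ _ (by simp)]
  rw [h1, h2]

end Density

/-! ### From the given sojourn times to the product law. -/

section Transfer

variable {A : ℕ} {Ω : Type*} [MeasurableSpace Ω] {P : Measure Ω}
  {F : Fin A → ℕ → ℝ} {x₀ : Fin A → ℕ} {τ : Fin A → ℕ → Ω → ℝ}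

lemma IsSojournTimes.hasLaw_sojournLaw (hτ : IsSojournTimes F τ P)
    (hF : ∀ j k, 1 ≤ k → 0 < F j k) (hx₀ : ∀ j, 1 ≤ x₀ j) :
    HasLaw (fun ω (p : Fin A × ℕ) => τ p.1 (x₀ p.1 + p.2) ω) (sojournLaw (rateAt F x₀)) P := by
  have hk : ∀ p : Fin A × ℕ, 1 ≤ x₀ p.1 + p.2 := fun p => (hx₀ p.1).trans (Nat.le_add_right _ _)
  have hinj : Function.Injective
      fun p : Fin A × ℕ => (p.1, (⟨x₀ p.1 + p.2, hk p⟩ : ℕ+)) := by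
    rintro ⟨j, k⟩ ⟨j', k'⟩ h
    simp only [Prod.mk.injEq, Subtype.mk.injEq] at h
    obtain ⟨rfl, h⟩ := h
    simpa using h
  have hlaw : ∀ p : Fin A × ℕ,
      HasLaw (τ p.1 (x₀ p.1 + p.2)) (expMeasure (rateAt F x₀ p)) P := fun p => by
    rw [rateAt_eq hF hx₀]
    exact hτ.hasLaw _ _ (hk p)
  exact iIndepFun.hasLaw_infinitePi hlaw (hτ.indep.precomp hinj)
    (aemeasurable_pi_iff.2 fun p => (hlaw p).aemeasurable)

lemma Explosive.summable_rateAt {F : Fin A → ℕ → ℝ} (hF : ∀ j k, 1 ≤ k → 0 < F j k)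
    (hx₀ : ∀ j, 1 ≤ x₀ j) {j : Fin A} (hj : Explosive (F j)) :
    Summable fun k => 1 / rateAt F x₀ (j, k) := by
  have h := (summable_nat_add_iff (x₀ j - 1)).2 hj
  refine h.congr fun k => ?_
  rw [rateAt_eq hF hx₀]
  congr 2
  have := hx₀ j
  simp only
  omega

lemma IsSojournTimes.explosionCDF_eq (hτ : IsSojournTimes F τ P)
    (hF : ∀ j k, 1 ≤ k → 0 < F j k) (hx₀ : ∀ j, 1 ≤ x₀ j) (i : Fin A) :
    explosionCDF x₀ τ P i = fun t : ℝ =>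
      (sojournLaw (rateAt F x₀)).real {σ | (totalTime i σ : EReal) ≤ (t : EReal)} :=
  funext fun t => (hτ.hasLaw_sojournLaw hF hx₀).measureReal_eq
    (p := fun σ => (totalTime i σ : EReal) ≤ (t : EReal))
    (measurableSet_le (measurable_coe_ennreal_ereal.comp (measurable_totalTime i)) measurable_const)

lemma IsSojournTimes.hasDerivAt_explosionCDF (hτ : IsSojournTimes F τ P)
    (hF : ∀ j k, 1 ≤ k → 0 < F j k) (hx₀ : ∀ j, 1 ≤ x₀ j) {i : Fin A} (hi : Explosive (F i)) (t : ℝ) :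
    HasDerivAt (explosionCDF x₀ τ P i)
      (∫⁻ σ, exponentialPDF (rateAt F x₀ (i, 0)) (t - (tailTime i σ).toReal)
        ∂sojournLaw (rateAt F x₀)).toReal t := by
  rw [hτ.explosionCDF_eq hF hx₀]
  exact hasDerivAt_sojournLaw_real_totalTime_le _ (hi.summable_rateAt hF hx₀) t

/-- The inner integral of `meanPDF_eq_lintegral_lintegral`, as a function of the value of the
minimum, is the derivative of the distribution function of `T_i`. -/
lemma IsSojournTimes.meanDensity_eq (hτ : IsSojournTimes F τ P)
    (hF : ∀ j k, 1 ≤ k → 0 < F j k) (hx₀ : ∀ j, 1 ≤ x₀ j) {i : Fin A} (hi : Explosive (F i)) :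
    meanDensity x₀ τ P i = (meanPDF (rateAt F x₀) i).toReal := by
  have hlaw := hτ.hasLaw_sojournLaw hF hx₀
  have hm : Measurable fun t : ℝ => ∫⁻ σ, exponentialPDF (rateAt F x₀ (i, 0))
      (t - (tailTime i σ).toReal) ∂sojournLaw (rateAt F x₀) := by
    refine Measurable.lintegral_prod_right' (f := fun z : ℝ × (Fin A × ℕ → ℝ) =>
      exponentialPDF (rateAt F x₀ (i, 0)) (z.1 - (tailTime i z.2).toReal)) ?_
    exact (measurable_exponentialPDF _).comp (by fun_prop)
  have hm' : Measurable fun σ : Fin A × ℕ → ℝ => ∫⁻ σ', exponentialPDF (rateAt F x₀ (i, 0))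
      ((minTotal i σ).toReal - (tailTime i σ').toReal) ∂sojournLaw (rateAt F x₀) :=
    hm.comp (measurable_minTotal i).ennreal_toReal
  rw [meanPDF_eq_lintegral_lintegral, ← integral_toReal hm'.aemeasurable]
  · rw [← hlaw.integral_comp hm'.ennreal_toReal.aestronglyMeasurable]
    refine integral_congr_ae (Eventually.of_forall fun ω => ?_)
    exact (hτ.hasDerivAt_explosionCDF hF hx₀ hi _).deriv
  · refine Eventually.of_forall fun σ => ?_
    refine (lintegral_mono fun σ' => exponentialPDF_le (Fact.out (p := ∀ p, 0 < rateAt F x₀ p) (i, 0))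
      _).trans_lt ?_
    simp

lemma IsSojournTimes.real_minOther_lt (hτ : IsSojournTimes F τ P)
    (hF : ∀ j k, 1 ≤ k → 0 < F j k) (hx₀ : ∀ j, 1 ≤ x₀ j) (i : Fin A) :
    P.real {ω | minOther x₀ τ i ω < explosionTime x₀ τ i ω} =
      (sojournLaw (rateAt F x₀)).real {σ | minTotal i σ < totalTime i σ} :=
  (hτ.hasLaw_sojournLaw hF hx₀).measureReal_eq
    (p := fun σ => minTotal i σ < totalTime i σ) (measurableSet_lt (by fun_prop) (by fun_prop))

end Transfer

/-! ### Equivalence of tail sums. -/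

section Tails

lemma tendsto_tsum_tail_div {a b : ℕ → ℝ} (hb : ∀ᶠ k in atTop, 0 < b k) (hsa : Summable a)
    (hsb : Summable b) (h : Tendsto (fun k => a k / b k) atTop (𝓝 1)) :
    Tendsto (fun x : ℕ => (∑' k, a (x + 1 + k)) / ∑' k, b (x + 1 + k)) atTop (𝓝 1) := by
  rw [Metric.tendsto_atTop]
  intro ε hε
  -- A relative error bound with positive `b` survives summation. Half of `ε` leaves room for the
  -- strict inequality at the end.
  have h1 : ∀ᶠ k in atTop, 0 < b k ∧ |a k - b k| ≤ ε / 2 * b k := by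
    filter_upwards [hb, Metric.tendsto_nhds.1 h (ε / 2) (half_pos hε)] with k hk hd
    refine ⟨hk, ?_⟩
    rw [Real.dist_eq, div_sub_one hk.ne', abs_div, abs_of_pos hk, div_lt_iff₀ hk] at hd
    exact hd.le
  obtain ⟨N, hN⟩ := eventually_atTop.1 h1
  refine ⟨N, fun x hx => ?_⟩
  have hshift : ∀ {f : ℕ → ℝ}, Summable f → Summable fun k => f (x + 1 + k) := fun hf => by
    simpa [add_comm] using (summable_nat_add_iff (x + 1)).2 hf
  have hk : ∀ k, 0 < b (x + 1 + k) ∧ |a (x + 1 + k) - b (x + 1 + k)| ≤ ε / 2 * b (x + 1 + k) :=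
    fun k => hN _ (by omega)
  have hpos : 0 < ∑' k, b (x + 1 + k) := (hshift hsb).tsum_pos (fun k => (hk k).1.le) 0 (hk 0).1
  have hle : |∑' k, a (x + 1 + k) - ∑' k, b (x + 1 + k)| ≤ ε / 2 * ∑' k, b (x + 1 + k) := by
    rw [← (hshift hsa).tsum_sub (hshift hsb), ← tsum_mul_left]
    exact tsum_of_norm_bounded (f := fun k => a (x + 1 + k) - b (x + 1 + k))
      ((hshift hsb).mul_left (ε / 2)).hasSum fun k => (hk k).2
  rw [Real.dist_eq, div_sub_one hpos.ne', abs_div, abs_of_pos hpos, div_lt_iff₀ hpos]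
  exact hle.trans_lt (mul_lt_mul_of_pos_right (half_lt_self hε) hpos)

end Tails

/-! ### Strong monopoly as an infinite final count. -/

section Monopoly

/-- Arrival times increase strictly to the explosion time, so all of them are below the minimum
exactly when the explosion time is at most the minimum; equality is included. -/
lemma sojournLaw_tendsto_lt_minTotal {A : ℕ} (r : Fin A × ℕ → ℝ) [hr : Fact (∀ p, 0 < r p)]
    (i : Fin A) :
    Tendsto (fun m => sojournLaw r {σ | ENNReal.ofReal (hitTime i m σ) < minTotal i σ}) atTop
      (𝓝 (sojournLaw r {σ | totalTime i σ ≤ minTotal i σ})) := by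
  refine tendsto_measure_of_ae_tendsto_indicator_of_isFiniteMeasure atTop
    (measurableSet_le (by fun_prop) (by fun_prop))
    (fun m => measurableSet_lt (by fun_prop) (by fun_prop)) ?_
  filter_upwards [ae_pos_sojournLaw r] with σ hσ
  rcases le_or_gt (totalTime i σ) (minTotal i σ) with h | h
  · refine Eventually.of_forall fun m => iff_of_true ?_ h
    refine lt_of_lt_of_le ?_ h
    have h1 : hitTime i m σ < hitTime i (m + 1) σ := by
      rw [hitTime, hitTime, Finset.sum_range_succ]
      exact lt_add_of_pos_right _ (hσ _)
    refine lt_of_lt_of_le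
      ((ENNReal.ofReal_lt_ofReal_iff_of_nonneg (hitTime_nonneg i m hσ)).2 h1) ?_
    rw [totalTime_eq_iSup i hσ]
    exact le_iSup (fun m => ENNReal.ofReal (hitTime i m σ)) (m + 1)
  · have h' := h
    rw [totalTime_eq_iSup i hσ] at h'
    obtain ⟨m, hm⟩ := lt_iSup_iff.1 h'
    filter_upwards [eventually_ge_atTop m] with n hn
    refine iff_of_false (fun h1 => ?_) (not_le.2 h)
    have h1 : ENNReal.ofReal (hitTime i n σ) < minTotal i σ := h1
    exact lt_asymm h1 (hm.trans_le (ENNReal.ofReal_le_ofReal (hitTime_mono i hσ hn)))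

/-- These events are almost surely disjoint: two of them together would force a tie, hence two
infinite explosion times below the finite `totalTime i`. -/
lemma sum_sojournLaw_totalTime_le {A : ℕ} (r : Fin A × ℕ → ℝ) [hr : Fact (∀ p, 0 < r p)]
    {i : Fin A} (hi : Summable fun k => 1 / r (i, k)) :
    ∑ j, sojournLaw r {σ | totalTime j σ ≤ minTotal j σ} ≤ 1 := by
  rw [← tsum_fintype (L := .unconditional _), ← measure_iUnion₀ _ fun j =>
    (measurableSet_le (measurable_totalTime j) (measurable_minTotal j)).nullMeasurableSet]
  · exact prob_le_one
  · intro j l hjl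
    refine measure_eq_zero_iff_ae_notMem.2 ?_
    filter_upwards [ae_totalTime_ne r hjl, ae_totalTime_lt_top r hi] with σ h1 h2 h
    have hmin : ∀ {j l : Fin A}, j ≠ l → minTotal l σ ≤ totalTime j σ := fun {j l} hjl =>
      iInf_le (fun j : {j : Fin A // j ≠ l} => totalTime j.1 σ) ⟨j, hjl⟩
    have hj : totalTime j σ ≤ minTotal j σ := h.1
    have hl : totalTime l σ ≤ minTotal l σ := h.2
    have htop := h1 (le_antisymm (hj.trans (hmin hjl.symm)) (hl.trans (hmin hjl)))
    rcases eq_or_ne i j with rfl | hij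
    · exact h2.ne htop
    · exact (hj.trans_lt ((hmin hij).trans_lt h2)).ne htop

lemma exists_le_of_finalCount_ne_top {A : ℕ} {Ω : Type*} {X : ℕ → Ω → Fin A → ℕ} {j : Fin A}
    {ω : Ω} (h : finalCount X j ω ≠ ⊤) : ∃ b, ∀ n, X n ω j ≤ b := by
  obtain ⟨b, hb⟩ := ENat.ne_top_iff_exists.1 h
  refine ⟨b, fun n => ?_⟩
  have := le_iSup (fun n => (X n ω j : ℕ∞)) n
  rw [show (⨆ n, (X n ω j : ℕ∞)) = b from hb.symm] at this
  exact_mod_cast this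

lemma finalCount_ne_top_of_le {A : ℕ} {Ω : Type*} {X : ℕ → Ω → Fin A → ℕ} {j : Fin A}
    {ω : Ω} {b : ℕ} (h : ∀ n, X n ω j ≤ b) : finalCount X j ω ≠ ⊤ :=
  ne_top_of_le_ne_top (ENat.natCast_ne_top b) (iSup_le fun n => by exact_mod_cast h n)

lemma setOf_finalCount_eq_top {A : ℕ} {Ω : Type*} (X : ℕ → Ω → Fin A → ℕ) (x₀ : Fin A → ℕ) (j : Fin A) :
    {ω | finalCount X j ω = ⊤} = ⋂ m : ℕ, {ω | ((x₀ j + m : ℕ) : ℕ∞) ≤ finalCount X j ω} := by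
  ext ω
  simp only [Set.mem_ofPred_eq, Set.mem_iInter]
  refine ⟨fun h m => by simp [h], fun h => ENat.eq_top_iff_forall_ge.2 fun m => ?_⟩
  exact le_trans (by exact_mod_cast Nat.le_add_left _ _) (h m)

lemma setOf_finalCount_eq {A : ℕ} {Ω : Type*} (X : ℕ → Ω → Fin A → ℕ) (j : Fin A) (c : ℕ) :
    {ω | finalCount X j ω = c} =
      {ω | (c : ℕ∞) ≤ finalCount X j ω} \ {ω | ((c + 1 : ℕ) : ℕ∞) ≤ finalCount X j ω} := by
  ext ω
  simp only [Set.mem_sdiff, Set.mem_ofPred_eq]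
  rw [Nat.cast_add, Nat.cast_one, ENat.add_one_le_iff (ENat.natCast_ne_top c), not_lt]
  exact ⟨fun h => ⟨h.ge, h.le⟩, fun h => le_antisymm h.2 h.1⟩

variable {A : ℕ} {Ω : Type*} [MeasurableSpace Ω] {μ : Measure Ω}
  {F : Fin A → ℕ → ℝ} {x₀ : Fin A → ℕ} {X : ℕ → Ω → Fin A → ℕ}

lemma IsUrn.measurableSet_finalCount_eq_top (hX : IsUrn F x₀ X μ) (j : Fin A) :
    MeasurableSet {ω | finalCount X j ω = ⊤} := by
  rw [setOf_finalCount_eq_top X x₀]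
  exact MeasurableSet.iInter fun m => hX.measurableSet_le_finalCount j _

lemma IsUrn.measurableSet_finalCount_eq (hX : IsUrn F x₀ X μ) (j : Fin A) (c : ℕ) :
    MeasurableSet {ω | finalCount X j ω = c} := by
  rw [setOf_finalCount_eq]
  exact (hX.measurableSet_le_finalCount j _).diff (hX.measurableSet_le_finalCount j _)

variable [IsProbabilityMeasure μ]

lemma IsUrn.measure_finalCount_eq_top (hX : IsUrn F x₀ X μ) (hF : ∀ j k, 1 ≤ k → 0 < F j k)
    (hx₀ : ∀ j, 1 ≤ x₀ j) (j : Fin A) :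
    μ {ω | finalCount X j ω = ⊤} =
      sojournLaw (rateAt F x₀) {σ | totalTime j σ ≤ minTotal j σ} := by
  have h1 : Tendsto (fun m : ℕ => μ {ω | ((x₀ j + m : ℕ) : ℕ∞) ≤ finalCount X j ω}) atTop
      (𝓝 (μ {ω | finalCount X j ω = ⊤})) := by
    rw [setOf_finalCount_eq_top X x₀]
    refine tendsto_measure_iInter_atTop
      (fun m => (hX.measurableSet_le_finalCount j _).nullMeasurableSet) (fun m m' h ω hω => ?_)
      ⟨0, measure_ne_top _ _⟩
    have h' : ((x₀ j + m : ℕ) : ℕ∞) ≤ ((x₀ j + m' : ℕ) : ℕ∞) := by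
      exact_mod_cast Nat.add_le_add_left h _
    exact h'.trans hω
  simp_rw [hX.measure_le_finalCount hF hx₀] at h1
  exact tendsto_nhds_unique h1 (sojournLaw_tendsto_lt_minTotal _ j)

/-- The total number of balls grows by one at every step, so the counts cannot all stay bounded. -/
lemma IsUrn.ae_exists_finalCount_eq_top (hX : IsUrn F x₀ X μ) [Nonempty (Fin A)]
    (hF : ∀ j k, 1 ≤ k → 0 < F j k) (hx₀ : ∀ j, 1 ≤ x₀ j) :
    ∀ᵐ ω ∂μ, ∃ j, finalCount X j ω = ⊤ := by
  filter_upwards [hX.ae_step hF hx₀] with ω hω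
  by_contra! h
  choose b hb using fun j => exists_le_of_finalCount_ne_top (h j)
  have hsum : ∀ n, n ≤ ∑ j, X n ω j := by
    intro n
    induction n with
    | zero => exact Nat.zero_le _
    | succ n ih =>
      obtain ⟨l, hl⟩ := hω n
      rw [hl]
      simpa [Finset.sum_add_distrib] using ih
  have h1 := hsum (∑ j, b j + 1)
  have h2 : ∑ j, X (∑ j, b j + 1) ω j ≤ ∑ j, b j := Finset.sum_le_sum fun j _ => hb j _
  omega

/-- If some colour is explosive, then almost surely at most one colour is drawn infinitely often. -/
lemma IsUrn.ae_finalCount_ne_top (hX : IsUrn F x₀ X μ) (hF : ∀ j k, 1 ≤ k → 0 < F j k)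
    (hx₀ : ∀ j, 1 ≤ x₀ j) {i : Fin A} (hi : Explosive (F i)) :
    ∀ᵐ ω ∂μ, finalCount X i ω = ⊤ → ∀ j, j ≠ i → finalCount X j ω ≠ ⊤ := by
  have : Nonempty (Fin A) := ⟨i⟩
  let B : Set Ω := ⋃ j ∈ Finset.univ.erase i, {ω | finalCount X j ω = ⊤}
  have hB : MeasurableSet B :=
    Finset.measurableSet_biUnion _ fun j _ => hX.measurableSet_finalCount_eq_top j
  have hunion : μ ({ω | finalCount X i ω = ⊤} ∪ B) = 1 := by
    rw [← mem_ae_iff_prob_eq_one ((hX.measurableSet_finalCount_eq_top i).union hB)]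
    filter_upwards [hX.ae_exists_finalCount_eq_top hF hx₀] with ω ⟨j, hj⟩
    by_cases hji : j = i
    · subst hji
      exact Or.inl hj
    · exact Or.inr (Set.mem_biUnion (Finset.mem_erase.2 ⟨hji, Finset.mem_univ j⟩) hj)
  -- The two events cover almost everything while their probabilities sum to at most one, so their
  -- intersection is null.
  have hsum : μ {ω | finalCount X i ω = ⊤} + μ B ≤ 1 :=
    calc μ {ω | finalCount X i ω = ⊤} + μ B
        ≤ μ {ω | finalCount X i ω = ⊤} + ∑ j ∈ Finset.univ.erase i, μ {ω | finalCount X j ω = ⊤} :=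
          add_le_add_right (measure_biUnion_finset_le _ _) _
      _ = ∑ j, μ {ω | finalCount X j ω = ⊤} :=
          Finset.add_sum_erase _ (fun j => μ {ω | finalCount X j ω = ⊤}) (Finset.mem_univ i)
      _ ≤ 1 := by
          simp_rw [hX.measure_finalCount_eq_top hF hx₀]
          exact sum_sojournLaw_totalTime_le _ (hi.summable_rateAt hF hx₀)
  have hinter : μ ({ω | finalCount X i ω = ⊤} ∩ B) = 0 := by
    have h := measure_union_add_inter {ω | finalCount X i ω = ⊤} hB (μ := μ)
    rw [hunion] at h
    have h' : 1 + μ ({ω | finalCount X i ω = ⊤} ∩ B) ≤ 1 + 0 := by rw [h, add_zero]; exact hsum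
    exact le_antisymm ((ENNReal.add_le_add_iff_left ENNReal.one_ne_top).1 h') zero_le
  filter_upwards [measure_eq_zero_iff_ae_notMem.1 hinter] with ω hω hit j hj hjt
  exact hω ⟨hit, Set.mem_biUnion (Finset.mem_erase.2 ⟨hj, Finset.mem_univ j⟩) hjt⟩

/-- The strong monopoly is almost surely the event that the colour is drawn infinitely often. -/
lemma IsUrn.strongMonopoly_ae_eq (hX : IsUrn F x₀ X μ) (hF : ∀ j k, 1 ≤ k → 0 < F j k)
    (hx₀ : ∀ j, 1 ≤ x₀ j) {i : Fin A} (hi : Explosive (F i)) :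
    strongMonopoly X i =ᵐ[μ] {ω | finalCount X i ω = ⊤} := by
  have : Nonempty (Fin A) := ⟨i⟩
  filter_upwards [hX.ae_finalCount_ne_top hF hx₀ hi, hX.ae_monotone hF hx₀,
    hX.ae_exists_finalCount_eq_top hF hx₀] with ω h1 hmono ⟨l, hl⟩
  refine propext ⟨?_, fun hit => ?_⟩
  · rintro ⟨N, hN⟩
    by_cases hli : l = i
    · subst hli; exact hl
    · refine (finalCount_ne_top_of_le (b := X N ω l) (fun n => ?_) hl).elim
      rcases le_total N n with h | h
      · exact (hN n h l hli).le
      · exact hmono h l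
  -- A bounded nondecreasing integer sequence is constant once it attains its maximum; finitely many
  -- colours allow a common time.
  · have hev : ∀ j, ∃ N, ∀ n ≥ N, j ≠ i → X n ω j = X N ω j := by
      intro j
      by_cases hj : j = i
      · exact ⟨0, fun _ _ h => (h hj).elim⟩
      obtain ⟨b, hb⟩ := exists_le_of_finalCount_ne_top (h1 hit j hj)
      have hfin : (Set.range fun n => X n ω j).Finite :=
        (Set.finite_Iic b).subset (Set.range_subset_iff.2 hb)
      obtain ⟨_, ⟨N, rfl⟩, hN⟩ := hfin.exists_maximalFor id _ (Set.range_nonempty _)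
      refine ⟨N, fun n hn _ => le_antisymm ?_ (hmono hn j)⟩
      exact hN ⟨n, rfl⟩ (hmono hn j)
    choose N hN using hev
    refine ⟨Finset.univ.sup N, fun n hn j hj => ?_⟩
    have hj' : N j ≤ Finset.univ.sup N := Finset.le_sup (Finset.mem_univ j)
    rw [hN j n (hj'.trans hn) hj, hN j _ hj' hj]

end Monopoly

/-! ### Asymptotics of the mass function and the conditional tail. -/

section Asymptotics

variable {A : ℕ} {Ω : Type*} [MeasurableSpace Ω] {μ : Measure Ω} [IsProbabilityMeasure μ]
  {F : Fin A → ℕ → ℝ} {x₀ : Fin A → ℕ} {X : ℕ → Ω → Fin A → ℕ}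

/-- The levels start at `x₀ i + 1`, so that the sojourn at the final level is distinct from the
first sojourn, with which it is exchanged. -/
lemma IsUrn.measure_finalCount_eq (hX : IsUrn F x₀ X μ) (hF : ∀ j k, 1 ≤ k → 0 < F j k)
    (hx₀ : ∀ j, 1 ≤ x₀ j) {i : Fin A} (hother : ∃ j, j ≠ i ∧ Explosive (F j)) (m : ℕ) :
    μ {ω | finalCount X i ω = (x₀ i + (m + 1) : ℕ)} =
      ENNReal.ofReal (1 / F i (x₀ i + (m + 1))) *
        ∫⁻ σ, exponentialPDF (rateAt F x₀ (i, 0)) ((minTotal i σ).toReal - partialTail i (m + 1) σ)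
          ∂sojournLaw (rateAt F x₀) := by
  obtain ⟨j, hji, hj⟩ := hother
  have h := sojournLaw_lt_minTotal_eq_add (rateAt F x₀) (i := i)
    ⟨j, hji, hj.summable_rateAt hF hx₀⟩ m
  rw [← hX.measure_le_finalCount hF hx₀, ← hX.measure_le_finalCount hF hx₀,
    rateAt_eq hF hx₀ (i, m + 1)] at h
  rw [setOf_finalCount_eq, measure_sdiff _ (hX.measurableSet_le_finalCount i _).nullMeasurableSet
    (measure_ne_top _ _), h]
  · exact ENNReal.add_sub_cancel_left (measure_ne_top _ _)
  · intro ω hω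
    have h' : ((x₀ i + (m + 1) : ℕ) : ℕ∞) ≤ ((x₀ i + (m + 1) + 1 : ℕ) : ℕ∞) := by
      exact_mod_cast Nat.le_succ _
    exact h'.trans hω

lemma IsUrn.tendsto_finalCount_eq (hX : IsUrn F x₀ X μ) (hF : ∀ j k, 1 ≤ k → 0 < F j k)
    (hx₀ : ∀ j, 1 ≤ x₀ j) {i : Fin A} (hi : Explosive (F i))
    (hother : ∃ j, j ≠ i ∧ Explosive (F j)) :
    Tendsto (fun x : ℕ => μ.real {ω | finalCount X i ω = (x : ℕ∞)} /
      ((meanPDF (rateAt F x₀) i).toReal / F i x)) atTop (𝓝 1) := by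
  have hi' := hi.summable_rateAt hF hx₀
  have hother' : ∃ j, j ≠ i ∧ Summable fun k => 1 / rateAt F x₀ (j, k) := by
    obtain ⟨j, hji, hj⟩ := hother
    exact ⟨j, hji, hj.summable_rateAt hF hx₀⟩
  have hc : 0 < (meanPDF (rateAt F x₀) i).toReal :=
    ENNReal.toReal_pos (meanPDF_ne_zero _ hi' hother') (meanPDF_ne_top _ _)
  rw [← tendsto_add_atTop_iff_nat (x₀ i + 1)]
  have hlim := (((ENNReal.tendsto_toReal (meanPDF_ne_top _ _)).comp
    (tendsto_lintegral_exponentialPDF (rateAt F x₀) hi')).div_const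
      (meanPDF (rateAt F x₀) i).toReal).comp (tendsto_add_atTop_nat 1)
  rw [div_self hc.ne'] at hlim
  refine hlim.congr fun m => ?_
  have hm : m + (x₀ i + 1) = x₀ i + (m + 1) := by omega
  have hFm : 0 < F i (x₀ i + (m + 1)) := hF i _ (by omega)
  rw [hm, measureReal_def, hX.measure_finalCount_eq hF hx₀ hother, ENNReal.toReal_mul,
    ENNReal.toReal_ofReal (by positivity)]
  simp only [Function.comp_apply]
  field_simp

lemma IsUrn.real_finalCount_ne_top (hX : IsUrn F x₀ X μ) (hF : ∀ j k, 1 ≤ k → 0 < F j k)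
    (hx₀ : ∀ j, 1 ≤ x₀ j) (i : Fin A) :
    μ.real {ω | finalCount X i ω = ⊤}ᶜ =
      (sojournLaw (rateAt F x₀)).real {σ | minTotal i σ < totalTime i σ} := by
  have h : {σ | minTotal i σ < totalTime i σ} = {σ | totalTime i σ ≤ minTotal i σ}ᶜ := by
    ext σ; simp
  rw [h, probReal_compl_eq_one_sub (hX.measurableSet_finalCount_eq_top i),
    probReal_compl_eq_one_sub (measurableSet_le (by fun_prop) (by fun_prop)), measureReal_def,
    measureReal_def, hX.measure_finalCount_eq_top hF hx₀]

lemma IsUrn.hasSum_finalCount_eq (hX : IsUrn F x₀ X μ) (i : Fin A) (x : ℕ) :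
    HasSum (fun k : ℕ => μ.real {ω | finalCount X i ω = ((x + k : ℕ) : ℕ∞)})
      (μ.real ({ω | finalCount X i ω = ⊤}ᶜ ∩ {ω | (x : ℕ∞) ≤ finalCount X i ω})) := by
  have hset : {ω | finalCount X i ω = ⊤}ᶜ ∩ {ω | (x : ℕ∞) ≤ finalCount X i ω} =
      ⋃ k : ℕ, {ω | finalCount X i ω = ((x + k : ℕ) : ℕ∞)} := by
    ext ω
    simp only [Set.mem_inter_iff, Set.mem_compl_iff, Set.mem_ofPred_eq, Set.mem_iUnion]
    constructor
    · rintro ⟨h1, h2⟩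
      obtain ⟨b, hb⟩ := ENat.ne_top_iff_exists.1 h1
      rw [← hb] at h2 ⊢
      have : x ≤ b := by exact_mod_cast h2
      exact ⟨b - x, by rw [Nat.add_sub_cancel' this]⟩
    · rintro ⟨k, hk⟩
      rw [hk]
      exact ⟨ENat.natCast_ne_top _, by exact_mod_cast Nat.le_add_right _ _⟩
  have hd : Pairwise (Function.onFun Disjoint
      fun k : ℕ => {ω | finalCount X i ω = ((x + k : ℕ) : ℕ∞)}) := by
    intro k l hkl
    refine Set.disjoint_left.2 fun ω h1 h2 => hkl ?_
    have h1 : finalCount X i ω = _ := h1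
    have : ((x + k : ℕ) : ℕ∞) = ((x + l : ℕ) : ℕ∞) := h1.symm.trans h2
    have : x + k = x + l := by exact_mod_cast this
    omega
  have hU := measure_iUnion (μ := μ) hd fun k => hX.measurableSet_finalCount_eq i (x + k)
  rw [hset, measureReal_def, hU, ENNReal.tsum_toReal_eq fun k => measure_ne_top _ _]
  exact ENNReal.hasSum_toReal (hU ▸ measure_ne_top μ _)

end Asymptotics

end PolyaUrn

theorem mainTheorem2 {A : ℕ} {Ω Ω' : Type*} [MeasurableSpace Ω] [MeasurableSpace Ω']
    (μ : Measure Ω) [IsProbabilityMeasure μ] (P : Measure Ω') [IsProbabilityMeasure P]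
    (F : Fin A → ℕ → ℝ) (hF : ∀ j k, 1 ≤ k → 0 < F j k)
    (x₀ : Fin A → ℕ) (hx₀ : ∀ j, 1 ≤ x₀ j)
    (X : ℕ → Ω → Fin A → ℕ) (hX : PolyaUrn.IsUrn F x₀ X μ)
    (τ : Fin A → ℕ → Ω' → ℝ) (hτ : PolyaUrn.IsSojournTimes F τ P)
    (i : Fin A) (hi : PolyaUrn.Explosive (F i))
    (hother : ∃ j, j ≠ i ∧ PolyaUrn.Explosive (F j)) :
    Differentiable ℝ (PolyaUrn.explosionCDF x₀ τ P i) ∧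
    Tendsto (fun x : ℕ =>
        μ.real {ω | PolyaUrn.finalCount X i ω = (x : ℕ∞)} /
          (PolyaUrn.meanDensity x₀ τ P i / F i x))
      atTop (𝓝 1) ∧
    Tendsto (fun x : ℕ =>
        (μ[|(PolyaUrn.strongMonopoly X i)ᶜ]).real {ω | (x : ℕ∞) < PolyaUrn.finalCount X i ω} /
          (PolyaUrn.meanDensity x₀ τ P i /
              P.real {ω | PolyaUrn.minOther x₀ τ i ω < PolyaUrn.explosionTime x₀ τ i ω} *
            ∑' k : ℕ, 1 / F i (x + 1 + k)))
      atTop (𝓝 1) := by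
  have hlim := hX.tendsto_finalCount_eq hF hx₀ hi hother
  have hi' := hi.summable_rateAt hF hx₀
  have hother' : ∃ j, j ≠ i ∧ Summable fun k => 1 / PolyaUrn.rateAt F x₀ (j, k) := by
    obtain ⟨j, hji, hj⟩ := hother
    exact ⟨j, hji, hj.summable_rateAt hF hx₀⟩
  rw [hτ.meanDensity_eq hF hx₀ hi, hτ.real_minOther_lt hF hx₀]
  refine ⟨fun t => (hτ.hasDerivAt_explosionCDF hF hx₀ hi t).differentiableAt, hlim, ?_⟩
  have hc : 0 < (PolyaUrn.meanPDF (PolyaUrn.rateAt F x₀) i).toReal :=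
    ENNReal.toReal_pos (PolyaUrn.meanPDF_ne_zero _ hi' hother') (PolyaUrn.meanPDF_ne_top _ _)
  have hp : 0 < (PolyaUrn.sojournLaw (PolyaUrn.rateAt F x₀)).real
      {σ | PolyaUrn.minTotal i σ < PolyaUrn.totalTime i σ} :=
    ENNReal.toReal_pos (PolyaUrn.sojournLaw_minTotal_lt_totalTime_pos _ hother').ne'
      (measure_ne_top _ _)
  set c := (PolyaUrn.meanPDF (PolyaUrn.rateAt F x₀) i).toReal
  have hmon := ae_eq_set_compl_compl.2 (hX.strongMonopoly_ae_eq hF hx₀ hi)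
  -- Conditioning depends on the event only up to null sets, so no measurability of `strongMonopoly`
  -- is required.
  have hcond : μ[|(PolyaUrn.strongMonopoly X i)ᶜ] =
      μ[|{ω | PolyaUrn.finalCount X i ω = ⊤}ᶜ] := by
    have h1 : μ (PolyaUrn.strongMonopoly X i)ᶜ = μ {ω | PolyaUrn.finalCount X i ω = ⊤}ᶜ :=
      measure_congr hmon
    have h2 : μ.restrict (PolyaUrn.strongMonopoly X i)ᶜ =
        μ.restrict {ω | PolyaUrn.finalCount X i ω = ⊤}ᶜ := Measure.restrict_congr_set hmon
    rw [ProbabilityTheory.cond, ProbabilityTheory.cond, h1, h2]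
  have hsa : Summable fun k : ℕ => μ.real {ω | PolyaUrn.finalCount X i ω = (k : ℕ∞)} := by
    simpa using (hX.hasSum_finalCount_eq i 0).summable
  -- The uncontrolled value `F i 0` adds a single term, which affects neither summability nor the
  -- tails.
  have hsb : Summable fun k : ℕ => c / F i k := by
    have h := (summable_nat_add_iff (f := fun k => 1 / F i k) 1).1 hi
    refine (h.mul_left c).congr fun k => by ring
  have hb : ∀ᶠ k in atTop, 0 < c / F i k := by
    filter_upwards [eventually_ge_atTop 1] with k hk using div_pos hc (hF i k hk)
  refine (PolyaUrn.tendsto_tsum_tail_div hb hsa hsb hlim).congr fun x => ?_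
  have hnum : (μ[|{ω | PolyaUrn.finalCount X i ω = ⊤}ᶜ]).real
      {ω | (x : ℕ∞) < PolyaUrn.finalCount X i ω} =
      (∑' k : ℕ, μ.real {ω | PolyaUrn.finalCount X i ω = ((x + 1 + k : ℕ) : ℕ∞)}) /
        (PolyaUrn.sojournLaw (PolyaUrn.rateAt F x₀)).real
          {σ | PolyaUrn.minTotal i σ < PolyaUrn.totalTime i σ} := by
    have hset : {ω | (x : ℕ∞) < PolyaUrn.finalCount X i ω} =
        {ω | ((x + 1 : ℕ) : ℕ∞) ≤ PolyaUrn.finalCount X i ω} := by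
      ext ω
      simp only [Set.mem_ofPred_eq]
      rw [Nat.cast_add, Nat.cast_one, ENat.add_one_le_iff (ENat.natCast_ne_top x)]
    rw [(hX.hasSum_finalCount_eq i (x + 1)).tsum_eq, ← hX.real_finalCount_ne_top hF hx₀, hset,
      measureReal_def, cond_apply (hX.measurableSet_finalCount_eq_top i).compl,
      ENNReal.toReal_mul, ENNReal.toReal_inv, div_eq_inv_mul]
    rfl
  have hden : ∑' k : ℕ, c / F i (x + 1 + k) = c * ∑' k : ℕ, 1 / F i (x + 1 + k) := by
    rw [← tsum_mul_left]
    exact tsum_congr fun k => by ring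
  rw [hcond, hnum, hden]
  field_simp
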